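/- **Setting.** Let $U,V\in C^2(\mathbb{R}^d)$ be such that $\mu(dx)=e^{-U(x)}dx$ and $\eta(dy)=e^{-V(y)}dy$ are probability measures on $\mathbb{R}^d$. Let $\alpha\in\mathbb{R}^d$, let $\beta\in\mathbb{R}^{d\times d}$ be invertible, let $\tau_0$ be symmetric positive definite, and set $\chi_0:=\tau_0^{-1}\beta$. For $t>0$ put $W^t(x,y)=-\log g_{t\tau_0}(y-(\alpha+\beta x))$, where $g_\tau$ is the density of the centered Gaussian law with covariance $\tau$. For a potential $W$ write $K_W(x,dy)=e^{-W(x,y)}dy$, $W^\flat(y,x)=W(x,y)$, and $K_W(I)(x)=\int y\,K_W(x,dy)$. For every $t>0$ suppose that the Schrödinger bridge $P^t_{\mu,\eta}$ from $\mu$ to $\eta$ exists, that is, the minimizer of the relative entropy $\mathcal H(Q\,|\,\mu\times K_{W^t})$ over all couplings $Q$ of $\mu$ and $\eta$, with finite minimum. Let $(\mathbb U^t,\mathbb V^t)$ be its Schrödinger potentials: measurable functions which solve, at every point and with finite integrals, the Schrödinger system $$\mathbb U^t=U+\log K_{W^t}(e^{-\mathbb V^t}),\qquad \mathbb V^t=V+\log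 K_{W^{t,\flat}}(e^{-\mathbb U^t}),$$ and for which $P^t_{\mu,\eta}=\mu\times K_{\mathbb W^t_{\mu,\eta}}$, where $$U(x)+\mathbb W^t_{\mu,\eta}(x,y)=\mathbb U^t(x)+W^t(x,y)+\mathbb V^t(y)=V(y)+\mathbb W^{t,\flat}_{\eta,\mu}(y,x).$$ The forward and backward entropic maps are $K_{\mathbb W^t_{\mu,\eta}}(I)$ and $K_{\mathbb W^{t,\flat}_{\eta,\mu}}(I)$. **Notation.** $\nabla h(x)$ is the matrix with entries $(\nabla h)_{ij}=\partial_{x_i}h^j$; $'$ is the transpose; $\ell_{\max},\ell_{\min}$ are the largest and smallest eigenvalues; $\le$ between symmetric matrices is the Loewner order; $u\,\sharp\, v=v^{1/2}(v^{-1/2}uv^{-1/2})^{1/2}v^{1/2}$ is the geometric mean of positive definite matrices. For matrices $A(t)$, $M$, write $A(t)\lesssim M$ as $t\to0^+$ if $\limsup_{t\to0^+}\ell_{\max}(A(t))\le\ell_{\max}(M)$ and, for every $\varepsilon>0$, $A(t)\le M+\varepsilon I$ for all sufficiently small $t>0$. Write $A(t)\gtrsim M$ if $\liminf_{t\to0^+}\ell_{\min}(A(t))\ge\ell_{\min}(M)$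 and, for every $\varepsilon>0$, $A(t)\ge M-\varepsilon I$ for all sufficiently small $t>0$. **Claim.** For every $t>0$ the integrals defining both entropic maps converge absolutely, both maps are differentiable on $\mathbb{R}^d$, and the matrices $\nabla K_{\mathbb W^t_{\mu,\eta}}(I)(x)\,\chi_0$ and $\nabla K_{\mathbb W^{t,\flat}_{\eta,\mu}}(I)(x)\,\chi_0'$ are symmetric for every $x$. Moreover: 1. If $\nabla^2U\le u_-^{-1}$ and $\nabla^2V\ge v_+^{-1}$ everywhere, for some positive definite $u_-,v_+$, then for every $x\in\mathbb{R}^d$, as $t\to0^+$, $$\nabla K_{\mathbb W^t_{\mu,\eta}}(I)(x)\,\chi_0\ \lesssim\ \chi_0'\big((\chi_0u_-\chi_0')^{-1}\,\sharp\, v_+\big)\chi_0,\qquad \nabla K_{\mathbb W^{t,\flat}_{\eta,\mu}}(I)(x)\,\chi_0'\ \gtrsim\ \chi_0\big((\chi_0'v_+\chi_0)^{-1}\,\sharp\, u_-\big)\chi_0'.$$ 2. If $\nabla^2U\ge u_+^{-1}$ and $\nabla^2V\le v_-^{-1}$ everywhere, for some positive definite $u_+,v_-$, then for every $x\in\mathbb{R}^d$,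 as $t\to0^+$, $$\nabla K_{\mathbb W^t_{\mu,\eta}}(I)(x)\,\chi_0\ \gtrsim\ \chi_0'\big((\chi_0u_+\chi_0')^{-1}\,\sharp\, v_-\big)\chi_0,\qquad \nabla K_{\mathbb W^{t,\flat}_{\eta,\mu}}(I)(x)\,\chi_0'\ \lesssim\ \chi_0\big((\chi_0'v_-\chi_0)^{-1}\,\sharp\, u_+\big)\chi_0'.$$ -/

import Mathlib

open MeasureTheory Filter Topology

noncomputable section

namespace EntropicMap

/-- The state space `ℝ^d` with its Euclidean norm and Lebesgue measure. -/
abbrev E (d : ℕ) : Type := EuclideanSpace ℝ (Fin d)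

/-- Real square matrices of size `d`. -/
abbrev Mat (d : ℕ) : Type := Matrix (Fin d) (Fin d) ℝ

/-! ### Matrices -/

/-- Loewner order: `A ≤ B` when `B - A` is symmetric positive semi-definite. -/
def LoewnerLE {d : ℕ} (A B : Mat d) : Prop := (B - A).PosSemidef

open scoped MatrixOrder in
/-- Principal square root `v^{1/2}` of a positive semi-definite matrix. -/
def msqrt {d : ℕ} (v : Mat d) : Mat d := CFC.sqrt v

/-- Geometric mean `u ♯ v = v^{1/2} (v^{-1/2} u v^{-1/2})^{1/2} v^{1/2}`. -/
def geomMean {d : ℕ} (u v : Mat d) : Mat d :=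
  msqrt v * msqrt ((msqrt v)⁻¹ * u * (msqrt v)⁻¹) * msqrt v

/-- Largest (real) eigenvalue. -/
def ellMax {d : ℕ} (A : Mat d) : ℝ := sSup (spectrum ℝ A)

/-- Smallest (real) eigenvalue. -/
def ellMin {d : ℕ} (A : Mat d) : ℝ := sInf (spectrum ℝ A)

/-! ### Differential operators -/

/-- The gradient matrix `∇h = [∇h^1, …, ∇h^d]`, with entries `(∇h)_{ij} = ∂_{x_i} h^j`
(the transpose of the Jacobian matrix). -/
def gradMatrix {d : ℕ} (h : E d → E d) (x : E d) : Mat d :=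
  Matrix.of fun i j => (fderiv ℝ h x (EuclideanSpace.single i 1)) j

/-- The Hessian matrix `∇²f(x)`. -/
def hessMatrix {d : ℕ} (f : E d → ℝ) (x : E d) : Mat d :=
  Matrix.of fun i j =>
    fderiv ℝ (fderiv ℝ f) x (EuclideanSpace.single i 1) (EuclideanSpace.single j 1)

/-! ### Gibbs measures, Gibbs transitions, Gaussian reference -/

/-- `λ_U(dx) = e^{-U(x)} dx`. -/
def gibbs {d : ℕ} (U : E d → ℝ) : Measure (E d) :=
  volume.withDensity fun x => ENNReal.ofReal (Real.exp (-U x))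

/-- `K_W(x, dy) = e^{-W(x,y)} dy`. -/
def gibbsKernel {d : ℕ} (W : E d → E d → ℝ) (x : E d) : Measure (E d) :=
  volume.withDensity fun y => ENNReal.ofReal (Real.exp (-W x y))

/-- `(λ_U × K_W)(d(x,y)) = λ_U(dx) K_W(x, dy)`. -/
def gibbsJoint {d : ℕ} (U : E d → ℝ) (W : E d → E d → ℝ) : Measure (E d × E d) :=
  ((volume : Measure (E d)).prod volume).withDensity fun p =>
    ENNReal.ofReal (Real.exp (-U p.1) * Real.exp (-W p.1 p.2))

/-- The conjugate potential `W^♭(y,x) = W(x,y)`. -/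
def conj {d : ℕ} (W : E d → E d → ℝ) : E d → E d → ℝ := fun y x => W x y

/-- Density at `z` of the centered Gaussian law on `ℝ^d` with covariance matrix `τ`. -/
def gaussDensity {d : ℕ} (τ : Mat d) (z : E d) : ℝ :=
  (Real.sqrt ((2 * Real.pi) • τ).det)⁻¹ *
    Real.exp (-(1 / 2) * (z.ofLp ⬝ᵥ (τ⁻¹).mulVec z.ofLp))

/-- The linear-Gaussian potential `W(x,y) = -log g_τ(y - (α + β x))`. -/
def linGaussPotential {d : ℕ} (α : E d) (β τ : Mat d) (x y : E d) : ℝ :=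
  -Real.log (gaussDensity τ (y - (α + WithLp.toLp 2 (β.mulVec x.ofLp))))

/-! ### Schrödinger bridges -/

/-- `Π(μ,η)`: probability measures with first marginal `μ` and second marginal `η`. -/
def IsCoupling {d : ℕ} (μ η : Measure (E d)) (Q : Measure (E d × E d)) : Prop :=
  IsProbabilityMeasure Q ∧ Q.map Prod.fst = μ ∧ Q.map Prod.snd = η

/-- `P` is the Schrödinger bridge from `μ` to `η` with reference `R`: the minimizer over `Π(μ,η)`
of the relative entropy w.r.t. `R`, the minimum being finite. -/
def IsSchrodingerBridge {d : ℕ} (μ η : Measure (E d)) (R P : Measure (E d × E d)) : Prop :=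
  IsCoupling μ η P ∧ InformationTheory.klDiv P R ≠ ⊤ ∧
    ∀ Q, IsCoupling μ η Q → InformationTheory.klDiv P R ≤ InformationTheory.klDiv Q R

/-- `(𝕌,𝕍)` solves the Schrödinger system
`𝕌 = U + log K_W(e^{-𝕍})`, `𝕍 = V + log K_{W^♭}(e^{-𝕌})`, all integrals being finite. -/
structure IsSchrodingerSystem {d : ℕ} (U V : E d → ℝ) (W : E d → E d → ℝ)
    (𝕌 𝕍 : E d → ℝ) : Prop where
  measurable_left : Measurable 𝕌
  measurable_right : Measurable 𝕍
  integrable_right : ∀ x, Integrable (fun y => Real.exp (-𝕍 y)) (gibbsKernel W x)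
  integrable_left : ∀ y, Integrable (fun x => Real.exp (-𝕌 x)) (gibbsKernel (conj W) y)
  left_eq : ∀ x, 𝕌 x = U x + Real.log (∫ y, Real.exp (-𝕍 y) ∂(gibbsKernel W x))
  right_eq : ∀ y, 𝕍 y = V y + Real.log (∫ x, Real.exp (-𝕌 x) ∂(gibbsKernel (conj W) y))

/-- Forward transition potential: `U(x) + 𝕎(x,y) = 𝕌(x) + W(x,y) + 𝕍(y)`. -/
def fwdPotential {d : ℕ} (U : E d → ℝ) (W : E d → E d → ℝ) (𝕌 𝕍 : E d → ℝ) : E d → E d → ℝ :=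
  fun x y => 𝕌 x + W x y + 𝕍 y - U x

/-- Backward transition potential: `V(y) + 𝕎^♭(y,x) = 𝕌(x) + W(x,y) + 𝕍(y)`. -/
def bwdPotential {d : ℕ} (V : E d → ℝ) (W : E d → E d → ℝ) (𝕌 𝕍 : E d → ℝ) : E d → E d → ℝ :=
  fun y x => 𝕌 x + W x y + 𝕍 y - V y

/-- Barycentric projection `K_W(I)(x) = ∫ y K_W(x, dy)`. -/
def bary {d : ℕ} (W : E d → E d → ℝ) (x : E d) : E d := ∫ y, y ∂(gibbsKernel W x)

/-- `(𝕌,𝕍)` are Schrödinger potentials of the bridge from `λ_U` to `λ_V` with reference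
`λ_U × K_W`: they solve the Schrödinger system and this bridge is `λ_U × K_𝕎`. -/
def IsBridgePotentials {d : ℕ} (U V : E d → ℝ) (W : E d → E d → ℝ) (𝕌 𝕍 : E d → ℝ) : Prop :=
  IsSchrodingerSystem U V W 𝕌 𝕍 ∧
    IsSchrodingerBridge (gibbs U) (gibbs V) (gibbsJoint U W)
      (gibbsJoint U (fwdPotential U W 𝕌 𝕍))

/-- `A(t) ≤ M` as `t → 0+`, in the sense of extremal eigenvalues
(`limsup ℓ_max(A(t)) ≤ ℓ_max(M)`) and of the Loewner order up to any `ε > 0`. -/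
def AsympUpper {d : ℕ} (A : ℝ → Mat d) (M : Mat d) : Prop :=
  limsup (fun t => ((ellMax (A t) : ℝ) : EReal)) (𝓝[>] (0 : ℝ)) ≤ ((ellMax M : ℝ) : EReal) ∧
    ∀ ε : ℝ, 0 < ε → ∀ᶠ t in 𝓝[>] (0 : ℝ), LoewnerLE (A t) (M + ε • (1 : Mat d))

/-- `A(t) ≥ M` as `t → 0+`, in the sense of extremal eigenvalues
(`liminf ℓ_min(A(t)) ≥ ℓ_min(M)`) and of the Loewner order up to any `ε > 0`. -/
def AsympLower {d : ℕ} (A : ℝ → Mat d) (M : Mat d) : Prop :=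
  ((ellMin M : ℝ) : EReal) ≤ liminf (fun t => ((ellMin (A t) : ℝ) : EReal)) (𝓝[>] (0 : ℝ)) ∧
    ∀ ε : ℝ, 0 < ε → ∀ᶠ t in 𝓝[>] (0 : ℝ), LoewnerLE (M - ε • (1 : Mat d)) (A t)

end EntropicMap

end

/-!
Both equations of the Schrödinger system express a potential through a log-Laplace transform, and
the gradients of the entropic maps are second derivatives of these transforms. All Hessian bounds
are carried as bounds on symmetric second differences (`secondDiff`), so that the potentials need
not be differentiated and the two variance inequalities below reduce to integral inequalities.

The reference potential is `W(x,y) = a(x) + b(y) - ⟪B x, y⟫` with `B = t⁻¹ χ₀`. Absorbing `a` and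
`b` into the Schrödinger potentials, `f = 𝕌 + a` and `g = 𝕍 + b` satisfy `f = U + (log L_g) ∘ B` and
`g = V + (log L_f) ∘ Bᵀ`, where `L_g(θ) = ∫ e^{-g(y) + ⟪θ, y⟫} dy` is finite for every `θ`
(`LapSystem`). The forward map at `x` is the mean of the law proportional to
`e^{-g(y) + ⟪B x, y⟫} dy`, so that `∇K(x) χ₀` is `t` times the Hessian at `x` of `(log L_g) ∘ B`,
which gives the differentiability and the symmetry.

Two inequalities feed one another. A lower bound on the second differences of `g` bounds those of
`log L_g` above by the dual quadratic form (Brascamp–Lieb, `LapFinite.secondDiff_logLap_le`, from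
the Prékopa–Leindler inequality). An upper bound on the second differences of `f` bounds those of
`log L_f` below (Cramér–Rao, `LapFinite.le_secondDiff_logLap`, by shifting the integration
variable). If `∇²U ≤ u⁻¹` and `∇²V ≥ v⁻¹`, going once around the system turns the bound
`∇K χ₀ ≤ χ₀ᵀ γ χ₀` into the same bound with `(t v⁻¹ + (t w + γ)⁻¹)⁻¹` in place of `γ`, where
`w = (χ₀ u χ₀ᵀ)⁻¹`.

The geometric mean `G = w ♯ v` is the positive definite solution of `G v⁻¹ G = w`. In coordinates
where `G` is the identity, `w` and `v⁻¹` become the same diagonal matrix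
(`exists_diagonalization_geomMean`), and the iteration becomes scalar. Starting from the a priori
bound given by `∇²V ≥ v⁻¹` alone, it passes `γ = G` after finitely many turns for each fixed `t`
(`Coords.secondDiff_logLap_right_le_sum`): hence the upper bound `∇K χ₀ ≤ χ₀ᵀ G χ₀` is true for every
`t > 0`. Inserted into the Cramér–Rao step it gives the lower bound on the backward map up to an
error `O(t)`, the limit being `G⁻¹`, which is the stated matrix by `mul_geomMean_mul_transpose`. The
second pair of bounds is the first one with the roles of the two marginals exchanged.
-/

noncomputable section

namespace EntropicMap

open scoped ENNReal Pointwise RealInnerProductSpace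

/-! ### The Prékopa–Leindler inequality -/

/-- The one-dimensional Brunn–Minkowski inequality for compact sets: up to the single point
`sSup K + sInf L`, the translates `K + sInf L` and `sSup K + L` are disjoint. -/
lemma volume_add_volume_le_of_isCompact {K L : Set ℝ} (hK : IsCompact K) (hL : IsCompact L)
    (hK0 : K.Nonempty) (hL0 : L.Nonempty) : volume K + volume L ≤ volume (K + L) := by
  set a := sSup K
  set b := sInf L
  have ha : a ∈ K := hK.sSup_mem hK0
  have hb : b ∈ L := hL.sInf_mem hL0
  have h1 : volume ((fun x => x + b) '' K) = volume K := by simp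
  have h2 : volume ((fun x => a + x) '' L) = volume L := by simp
  have hmeas : MeasurableSet ((fun x => a + x) '' L) :=
    (hL.image (by fun_prop)).isClosed.measurableSet
  have hdisj : AEDisjoint volume ((fun x => x + b) '' K) ((fun x => a + x) '' L) := by
    refine measure_mono_null (t := {a + b}) ?_ (by simp)
    rintro z ⟨⟨x, hx, rfl⟩, ⟨y, hy, hxy⟩⟩
    have hxa : x ≤ a := le_csSup hK.bddAbove hx
    have hyb : b ≤ y := csInf_le hL.bddBelow hy
    simp only [Set.mem_singleton_iff] at *
    linarith
  rw [← h1, ← h2, ← measure_union₀ hmeas.nullMeasurableSet hdisj]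
  refine measure_mono ?_
  rintro z (⟨x, hx, rfl⟩ | ⟨y, hy, rfl⟩)
  · exact Set.add_mem_add hx hb
  · exact Set.add_mem_add ha hy

lemma volume_add_volume_le_of_midpoint {A B C : Set ℝ} (hA : MeasurableSet A)
    (hB : MeasurableSet B) (hA0 : A.Nonempty) (hB0 : B.Nonempty)
    (h : ∀ x ∈ A, ∀ y ∈ B, (x + y) / 2 ∈ C) : volume A + volume B ≤ 2 * volume C := by
  obtain ⟨a, ha⟩ := hA0
  obtain ⟨b, hb⟩ := hB0
  rw [hA.measure_eq_iSup_isCompact, hB.measure_eq_iSup_isCompact]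
  simp only [iSup_and']
  refine ENNReal.biSup_add_biSup_le' ⟨∅, by simp⟩ ⟨∅, by simp⟩ ?_
  rintro K ⟨hKA, hK⟩ L ⟨hLB, hL⟩
  have key := volume_add_volume_le_of_isCompact (hK.insert a) (hL.insert b)
    (Set.insert_nonempty _ _) (Set.insert_nonempty _ _)
  calc volume K + volume L ≤ volume (insert a K) + volume (insert b L) := by
        gcongr <;> exact Set.subset_insert _ _
    _ ≤ _ := key
    _ ≤ volume ((2 : ℝ) • C) := by
        refine measure_mono ?_
        rintro z ⟨x, hx, y, hy, rfl⟩
        have hx' : x ∈ A := by rcases hx with rfl | hx; exacts [ha, hKA hx]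
        have hy' : y ∈ B := by rcases hy with rfl | hy; exacts [hb, hLB hy]
        exact ⟨_, h x hx' y hy', by simp [mul_div_cancel₀]⟩
    _ = 2 * volume C := by
        rw [Measure.addHaar_smul]; simp

/-- The additive form of the one-dimensional inequality, for functions of supremum `1`: apply
Brunn–Minkowski to the superlevel sets and integrate over the level. -/
lemma lintegral_add_lintegral_le_of_min_le {f g h : ℝ → ℝ} (hf : Measurable f) (hg : Measurable g)
    (hh : Measurable h) (hf0 : ∀ x, 0 ≤ f x) (hg0 : ∀ x, 0 ≤ g x) (hh0 : ∀ x, 0 ≤ h x)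
    (hf1 : ∀ x, f x ≤ 1) (hg1 : ∀ x, g x ≤ 1)
    (hfs : ∀ s < 1, ∃ x, s < f x) (hgs : ∀ s < 1, ∃ x, s < g x)
    (H : ∀ x y, min (f x) (g y) ≤ h ((x + y) / 2)) :
    (∫⁻ x, ENNReal.ofReal (f x)) + ∫⁻ x, ENNReal.ofReal (g x)
      ≤ 2 * ∫⁻ x, ENNReal.ofReal (h x) := by
  have anti : ∀ k : ℝ → ℝ, Measurable fun t => volume {a : ℝ | t < k a} := fun k =>
    Antitone.measurable fun s t hst => measure_mono fun a (ha : t < k a) => lt_of_le_of_lt hst ha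
  rw [lintegral_eq_lintegral_meas_lt volume (.of_forall hf0) hf.aemeasurable,
    lintegral_eq_lintegral_meas_lt volume (.of_forall hg0) hg.aemeasurable,
    lintegral_eq_lintegral_meas_lt volume (.of_forall hh0) hh.aemeasurable,
    ← lintegral_add_left (anti f), ← lintegral_const_mul _ (anti h)]
  refine lintegral_mono fun t => ?_
  rcases lt_or_ge t 1 with ht | ht
  · refine volume_add_volume_le_of_midpoint (measurableSet_lt measurable_const hf)
      (measurableSet_lt measurable_const hg) (hfs t ht) (hgs t ht) ?_
    intro x hx y hy
    exact lt_of_lt_of_le (lt_min hx hy) (H x y)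
  · have h1 : {a : ℝ | t < f a} = ∅ :=
      Set.eq_empty_of_forall_notMem fun a (ha : t < f a) => absurd (hf1 a) (by linarith)
    have h2 : {a : ℝ | t < g a} = ∅ :=
      Set.eq_empty_of_forall_notMem fun a (ha : t < g a) => absurd (hg1 a) (by linarith)
    simp [h1, h2]

lemma ennreal_mul_le_sq_of_add_le_two_mul {a b c : ℝ≥0∞} (h : a + b ≤ 2 * c) : a * b ≤ c ^ 2 := by
  rcases eq_or_ne c ⊤ with rfl | hc
  · simp
  have hab : a + b ≠ ⊤ := ne_top_of_le_ne_top (ENNReal.mul_ne_top (by simp) hc) h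
  lift c to NNReal using hc
  lift a to NNReal using (fun h => hab (by simp [h]))
  lift b to NNReal using (fun h => hab (by simp [h]))
  norm_cast at h ⊢
  rw [← NNReal.coe_le_coe] at h ⊢
  push_cast at h ⊢
  nlinarith [sq_nonneg ((a : ℝ) - b), a.2, b.2, c.2, mul_self_le_mul_self (by positivity) h]

/-- The bounded case follows from the additive form by dividing `f` and `g` by their suprema and `h`
by the geometric mean of these; the arithmetic-geometric mean inequality returns to products. -/
lemma prekopa_leindler_real_of_bounded {f g h : ℝ → ℝ} (hf : Measurable f) (hg : Measurable g)
    (hh : Measurable h) (hf0 : ∀ x, 0 ≤ f x) (hg0 : ∀ x, 0 ≤ g x) (hh0 : ∀ x, 0 ≤ h x)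
    (hfb : BddAbove (Set.range f)) (hgb : BddAbove (Set.range g))
    (H : ∀ x y, f x * g y ≤ h ((x + y) / 2) ^ 2) :
    (∫⁻ x, ENNReal.ofReal (f x)) * ∫⁻ x, ENNReal.ofReal (g x)
      ≤ (∫⁻ x, ENNReal.ofReal (h x)) ^ 2 := by
  set F := ⨆ x, f x
  set G := ⨆ x, g x
  have hfF : ∀ x, f x ≤ F := le_ciSup hfb
  have hgG : ∀ x, g x ≤ G := le_ciSup hgb
  rcases ((hf0 0).trans (hfF 0)).eq_or_lt with hF | hF
  · have : ∀ x, f x = 0 := fun x => le_antisymm (hF ▸ hfF x) (hf0 x)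
    simp [this]
  rcases ((hg0 0).trans (hgG 0)).eq_or_lt with hG | hG
  · have : ∀ x, g x = 0 := fun x => le_antisymm (hG ▸ hgG x) (hg0 x)
    simp [this]
  set S := √(F * G)
  have hS : 0 < S := Real.sqrt_pos.2 (by positivity)
  have hS2 : S ^ 2 = F * G := Real.sq_sqrt (by positivity)
  have key := lintegral_add_lintegral_le_of_min_le (f := fun x => f x / F) (g := fun x => g x / G)
    (h := fun x => h x / S) (by fun_prop) (by fun_prop) (by fun_prop)
    (fun x => div_nonneg (hf0 x) hF.le) (fun x => div_nonneg (hg0 x) hG.le)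
    (fun x => div_nonneg (hh0 x) hS.le) (fun x => (div_le_one hF).2 (hfF x))
    (fun x => (div_le_one hG).2 (hgG x))
    (fun s hs => by
      obtain ⟨x, hx⟩ := exists_lt_of_lt_ciSup (show s * F < ⨆ x, f x by nlinarith)
      exact ⟨x, (lt_div_iff₀ hF).2 hx⟩)
    (fun s hs => by
      obtain ⟨x, hx⟩ := exists_lt_of_lt_ciSup (show s * G < ⨆ x, g x by nlinarith)
      exact ⟨x, (lt_div_iff₀ hG).2 hx⟩)
    (fun x y => by
      refine abs_le_of_sq_le_sq' ?_ (div_nonneg (hh0 _) hS.le) |>.2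
      have hm : min (f x / F) (g y / G) ^ 2 ≤ (f x / F) * (g y / G) := by
        rw [sq]
        exact mul_le_mul (min_le_left _ _) (min_le_right _ _)
          (le_min (div_nonneg (hf0 x) hF.le) (div_nonneg (hg0 y) hG.le))
          (div_nonneg (hf0 x) hF.le)
      refine hm.trans ?_
      rw [div_mul_div_comm, div_pow, hS2]
      gcongr
      exact H x y)
  have sc : ∀ (k : ℝ → ℝ) (c : ℝ), 0 < c → Measurable k →
      ∫⁻ x, ENNReal.ofReal (k x) = ENNReal.ofReal c * ∫⁻ x, ENNReal.ofReal (k x / c) := by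
    intro k c hc hk
    rw [← lintegral_const_mul _ (by fun_prop)]
    refine lintegral_congr fun x => ?_
    rw [← ENNReal.ofReal_mul hc.le, mul_div_cancel₀ _ hc.ne']
  rw [sc f F hF hf, sc g G hG hg, sc h S hS hh, mul_mul_mul_comm, mul_pow,
    ← ENNReal.ofReal_mul hF.le, ← hS2, ENNReal.ofReal_pow hS.le]
  gcongr
  exact ennreal_mul_le_sq_of_add_le_two_mul key

lemma prekopa_leindler_real {f g h : ℝ → ℝ≥0∞} (hf : Measurable f) (hg : Measurable g)
    (hh : Measurable h) (H : ∀ x y, f x * g y ≤ h ((x + y) / 2) ^ 2) :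
    (∫⁻ x, f x) * ∫⁻ x, g x ≤ (∫⁻ x, h x) ^ 2 := by
  have trunc : ∀ k : ℝ → ℝ≥0∞, Measurable k →
      ∫⁻ x, k x = ⨆ n : ℕ, ∫⁻ x, min (k x) n := by
    intro k hk
    rw [← lintegral_iSup (fun n => hk.min measurable_const)
      (fun m n hmn x => min_le_min_left _ (by exact_mod_cast hmn))]
    refine lintegral_congr fun x => ?_
    rw [← inf_iSup_eq, ENNReal.iSup_natCast, inf_top_eq]
  have mono : ∀ k : ℝ → ℝ≥0∞, Monotone fun n : ℕ => ∫⁻ x, min (k x) n := fun k m n hmn =>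
    lintegral_mono fun x => min_le_min_left _ (by exact_mod_cast hmn)
  rw [trunc f hf, trunc g hg, ENNReal.iSup_mul]
  refine iSup_le fun i => ?_
  rw [ENNReal.mul_iSup]
  refine iSup_le fun j => ?_
  set n := max i j
  refine (mul_le_mul' (mono f (le_max_left i j)) (mono g (le_max_right i j))).trans ?_
  have nt : ∀ (k : ℝ → ℝ≥0∞) x, min (k x) n ≠ ⊤ := fun k x =>
    ne_top_of_le_ne_top (ENNReal.natCast_ne_top n) (min_le_right _ _)
  have bd : ∀ k : ℝ → ℝ≥0∞, BddAbove (Set.range fun x => (min (k x) n).toReal) := by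
    rintro k
    refine ⟨n, ?_⟩
    rintro _ ⟨x, rfl⟩
    exact ENNReal.toReal_le_of_le_ofReal (by positivity) (by simp)
  have key := prekopa_leindler_real_of_bounded (f := fun x => (min (f x) n).toReal)
    (g := fun x => (min (g x) n).toReal) (h := fun x => (min (h x) n).toReal)
    (by fun_prop) (by fun_prop) (by fun_prop) (fun _ => ENNReal.toReal_nonneg)
    (fun _ => ENNReal.toReal_nonneg) (fun _ => ENNReal.toReal_nonneg) (bd f) (bd g)
    (fun x y => by
      rw [← ENNReal.toReal_mul, ← ENNReal.toReal_pow]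
      refine ENNReal.toReal_mono (ENNReal.pow_ne_top (nt h _)) ?_
      rcases le_total (h ((x + y) / 2)) n with hn | hn
      · rw [min_eq_left hn]
        exact (mul_le_mul' (min_le_left _ _) (min_le_left _ _)).trans (H x y)
      · rw [min_eq_right hn, sq]
        exact mul_le_mul' (min_le_right _ _) (min_le_right _ _))
  simp only [ENNReal.ofReal_toReal (nt _ _)] at key
  refine key.trans ?_
  gcongr
  exact min_le_left _ _

lemma lintegral_fin_succ {n : ℕ} {f : (Fin (n + 1) → ℝ) → ℝ≥0∞} (hf : Measurable f) :
    ∫⁻ z, f z = ∫⁻ a : ℝ, ∫⁻ x : Fin n → ℝ, f (Fin.cons a x) := by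
  rw [← ((volume_preserving_piFinSuccAbove (fun _ : Fin (n + 1) => ℝ) 0).symm).lintegral_comp hf,
    Measure.volume_eq_prod, lintegral_prod _ (by fun_prop)]
  simp [MeasurableEquiv.piFinSuccAbove_symm_apply, Fin.insertNthEquiv]

/-- The Prékopa–Leindler inequality at the midpoint, by induction on the dimension: the marginals
of `f`, `g`, `h` over all coordinates but the first satisfy the one-dimensional hypothesis. -/
lemma prekopa_leindler_pi (n : ℕ) {f g h : (Fin n → ℝ) → ℝ≥0∞} (hf : Measurable f)
    (hg : Measurable g) (hh : Measurable h)
    (H : ∀ x y, f x * g y ≤ h ((1 / 2 : ℝ) • (x + y)) ^ 2) :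
    (∫⁻ x, f x) * ∫⁻ x, g x ≤ (∫⁻ x, h x) ^ 2 := by
  induction n with
  | zero =>
    have hv : (volume : Measure (Fin 0 → ℝ)) = Measure.dirac 0 := by
      rw [volume_pi, Measure.pi_of_empty _ 0]
    simpa [hv, hf, hg, hh, lintegral_dirac'] using H 0 0
  | succ n ih =>
    have hc : Measurable fun p : ℝ × (Fin n → ℝ) => (Fin.cons p.1 p.2 : Fin (n + 1) → ℝ) := by
      refine measurable_pi_lambda _ fun i => ?_
      refine Fin.cases ?_ (fun j => ?_) i
      · simpa using measurable_fst
      · simp only [Fin.cons_succ]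
        fun_prop
    rw [lintegral_fin_succ hf, lintegral_fin_succ hg, lintegral_fin_succ hh]
    refine prekopa_leindler_real (hf.comp hc).lintegral_prod_right'
      (hg.comp hc).lintegral_prod_right' (hh.comp hc).lintegral_prod_right' fun a b => ?_
    refine ih ((hf.comp hc).comp measurable_prodMk_left) ((hg.comp hc).comp measurable_prodMk_left)
      ((hh.comp hc).comp measurable_prodMk_left) fun x y => ?_
    refine (H _ _).trans_eq ?_
    congr 2
    ext i
    refine Fin.cases ?_ (fun j => ?_) i <;> simp <;> ring

lemma prekopa_leindler {d : ℕ} {f g h : E d → ℝ≥0∞} (hf : Measurable f)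
    (hg : Measurable g) (hh : Measurable h)
    (H : ∀ x y, f x * g y ≤ h ((1 / 2 : ℝ) • (x + y)) ^ 2) :
    (∫⁻ x, f x) * ∫⁻ x, g x ≤ (∫⁻ x, h x) ^ 2 := by
  have e := PiLp.volume_preserving_toLp (Fin d)
  rw [← e.lintegral_comp hf, ← e.lintegral_comp hg, ← e.lintegral_comp hh]
  exact prekopa_leindler_pi d (by fun_prop) (by fun_prop) (by fun_prop) fun x y => H _ _

variable {d : ℕ}

/-! ### Second differences of log-Laplace transforms -/

/-- The symmetric second difference of `f` at `x` in direction `s`. For a smooth function it is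
`⟨∇²f(x) s, s⟩` to second order in `s`. -/
def secondDiff {d : ℕ} (f : E d → ℝ) (x s : E d) : ℝ := f (x + s) + f (x - s) - 2 * f x

/-- The Laplace transform of `e^{-f(y)} dy`. -/
def lap {d : ℕ} (f : E d → ℝ) (θ : E d) : ℝ := ∫ y, Real.exp (-f y + ⟪θ, y⟫)

/-- The logarithm of the Laplace transform of `e^{-f(y)} dy`. -/
def logLap {d : ℕ} (f : E d → ℝ) (θ : E d) : ℝ := Real.log (lap f θ)

/-- `f` is measurable and `e^{-f(y)} dy` has finite exponential moments. -/
structure LapFinite {d : ℕ} (f : E d → ℝ) : Prop where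
  measurable : Measurable f
  integrable : ∀ θ : E d, Integrable fun y => Real.exp (-f y + ⟪θ, y⟫)

lemma LapFinite.lap_pos {f : E d → ℝ} (hf : LapFinite f) (θ : E d) : 0 < lap f θ :=
  integral_exp_pos (hf.integrable θ)

lemma LapFinite.exp_logLap {f : E d → ℝ} (hf : LapFinite f) (θ : E d) :
    Real.exp (logLap f θ) = lap f θ := Real.exp_log (hf.lap_pos θ)

/-- A strongly convex potential has a log-Laplace transform whose second differences are bounded
above by the dual quadratic form (here through the polarity `2⟪σ, s⟫ ≤ Q s + R`): an integrated
form of the Brascamp–Lieb covariance inequality. -/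
lemma LapFinite.secondDiff_logLap_le {f : E d → ℝ} (hf : LapFinite f) {Q : E d → ℝ} {R : ℝ}
    {σ : E d} (hQ : ∀ y s, Q s ≤ secondDiff f y s) (hR : ∀ s, 2 * ⟪σ, s⟫ ≤ Q s + R) (θ : E d) :
    secondDiff (logLap f) θ σ ≤ R := by
  have hm := hf.measurable
  have key := prekopa_leindler (d := d)
    (f := fun y => ENNReal.ofReal (Real.exp (-f y + ⟪θ + σ, y⟫)))
    (g := fun y => ENNReal.ofReal (Real.exp (-f y + ⟪θ - σ, y⟫)))
    (h := fun y => ENNReal.ofReal (Real.exp (R / 2) * Real.exp (-f y + ⟪θ, y⟫)))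
    (by fun_prop) (by fun_prop) (by fun_prop) (fun x y => by
      rw [← ENNReal.ofReal_mul (Real.exp_pos _).le, ← ENNReal.ofReal_pow (by positivity),
        ← Real.exp_add, ← Real.exp_add, ← Real.exp_nat_mul]
      refine ENNReal.ofReal_le_ofReal (Real.exp_le_exp.2 ?_)
      have h1 := hQ ((1 / 2 : ℝ) • (x + y)) ((1 / 2 : ℝ) • (x - y))
      have h2 := hR ((1 / 2 : ℝ) • (x - y))
      rw [secondDiff, show (1 / 2 : ℝ) • (x + y) + (1 / 2 : ℝ) • (x - y) = x by module,
        show (1 / 2 : ℝ) • (x + y) - (1 / 2 : ℝ) • (x - y) = y by module] at h1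
      simp only [inner_add_left, inner_sub_left, inner_add_right, inner_sub_right,
        inner_smul_right] at *
      push_cast
      linarith)
  rw [← ofReal_integral_eq_lintegral_ofReal (hf.integrable _) (.of_forall fun _ => by positivity),
    ← ofReal_integral_eq_lintegral_ofReal (hf.integrable _) (.of_forall fun _ => by positivity),
    ← ofReal_integral_eq_lintegral_ofReal ((hf.integrable _).const_mul _)
      (.of_forall fun _ => by positivity), integral_const_mul] at key
  change ENNReal.ofReal (lap f _) * ENNReal.ofReal (lap f _)
    ≤ ENNReal.ofReal (_ * lap f _) ^ 2 at key
  have p := hf.lap_pos θ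
  rw [← ENNReal.ofReal_mul (hf.lap_pos _).le, ← ENNReal.ofReal_pow (by positivity),
    ENNReal.ofReal_le_ofReal_iff (by positivity)] at key
  rw [← hf.exp_logLap, ← hf.exp_logLap, ← hf.exp_logLap, ← Real.exp_add, ← Real.exp_add,
    ← Real.exp_nat_mul, Real.exp_le_exp] at key
  unfold secondDiff
  push_cast at key
  linarith

/-- An upper bound on the second differences of a potential in one direction `δ` bounds those of
its log-Laplace transform below: an integrated form of the Cramér–Rao inequality. It compares the
three Laplace integrals after shifting the variable by `δ`, `-δ` and `0`. -/
lemma LapFinite.le_secondDiff_logLap {f : E d → ℝ} (hf : LapFinite f) {δ : E d} {G : ℝ}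
    (hG : ∀ x, secondDiff f x δ ≤ G) (θ σ : E d) :
    2 * ⟪σ, δ⟫ - G ≤ secondDiff (logLap f) θ σ := by
  set a := logLap f (θ + σ)
  set b := logLap f (θ - σ)
  set c := ⟪σ, δ⟫ - G / 2 - (a + b) / 2
  have i1 : Integrable fun x => Real.exp (-a) * Real.exp (-f (x + δ) + ⟪θ + σ, x + δ⟫) :=
    ((hf.integrable (θ + σ)).comp_add_right δ).const_mul _
  have i2 : Integrable fun x => Real.exp (-b) * Real.exp (-f (x - δ) + ⟪θ - σ, x - δ⟫) :=
    ((hf.integrable (θ - σ)).comp_sub_right δ).const_mul _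
  have j1 : ∫ x, Real.exp (-a) * Real.exp (-f (x + δ) + ⟪θ + σ, x + δ⟫) = 1 := by
    rw [integral_const_mul,
      integral_add_right_eq_self (fun x => Real.exp (-f x + ⟪θ + σ, x⟫)) δ]
    change _ * lap f _ = 1
    rw [← hf.exp_logLap, ← Real.exp_add]; simp [a]
  have j2 : ∫ x, Real.exp (-b) * Real.exp (-f (x - δ) + ⟪θ - σ, x - δ⟫) = 1 := by
    rw [integral_const_mul,
      integral_sub_right_eq_self (fun x => Real.exp (-f x + ⟪θ - σ, x⟫)) δ]
    change _ * lap f _ = 1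
    rw [← hf.exp_logLap, ← Real.exp_add]; simp [b]
  have amgm : ∀ p q : ℝ, 2 * Real.exp ((p + q) / 2) ≤ Real.exp p + Real.exp q := fun p q => by
    have h1 : Real.exp p = Real.exp (p / 2) ^ 2 := by rw [← Real.exp_nat_mul]; congr 1; push_cast; ring
    have h2 : Real.exp q = Real.exp (q / 2) ^ 2 := by rw [← Real.exp_nat_mul]; congr 1; push_cast; ring
    have h3 : Real.exp ((p + q) / 2) = Real.exp (p / 2) * Real.exp (q / 2) := by
      rw [← Real.exp_add]; congr 1; ring
    rw [h1, h2, h3]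
    nlinarith [sq_nonneg (Real.exp (p / 2) - Real.exp (q / 2))]
  -- The midpoint convexity of `exp`, applied to the logarithms of the two shifted densities.
  have key : ∫ x, 2 * Real.exp c * Real.exp (-f x + ⟪θ, x⟫) ≤ 1 + 1 := by
    refine le_trans ?_ ((integral_add i1 i2).trans (congrArg₂ (· + ·) j1 j2)).le
    refine integral_mono ((hf.integrable θ).const_mul _) (i1.add i2) fun x => ?_
    simp only [← Real.exp_add]
    refine le_trans ?_ (amgm _ _)
    rw [mul_assoc, ← Real.exp_add]
    gcongr
    have := hG x
    unfold secondDiff at this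
    simp only [inner_add_left, inner_sub_left, inner_add_right, inner_sub_right, c] at *
    linarith
  rw [integral_const_mul] at key
  change _ * lap f θ ≤ _ at key
  rw [← hf.exp_logLap, mul_assoc, ← Real.exp_add] at key
  have : Real.exp (c + logLap f θ) ≤ Real.exp 0 := by rw [Real.exp_zero]; linarith
  have := Real.exp_le_exp.1 this
  simp only [secondDiff, c, a, b] at *
  linarith

/-! ### The Schrödinger system as a pair of coupled log-Laplace transforms -/

/-- The Schrödinger system for a bilinear interaction `⟪B x, y⟫`, the parts of the reference
potential that depend on one variable only being absorbed into `f` and `g`. -/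
structure LapSystem (U V : E d → ℝ) (B : E d →L[ℝ] E d) (f g : E d → ℝ) : Prop where
  left : LapFinite f
  right : LapFinite g
  left_eq : ∀ x, f x = U x + logLap g (B x)
  right_eq : ∀ y, g y = V y + logLap f (B.adjoint y)

lemma LapSystem.swap {U V : E d → ℝ} {B : E d →L[ℝ] E d} {f g : E d → ℝ}
    (h : LapSystem U V B f g) : LapSystem V U B.adjoint g f where
  left := h.right
  right := h.left
  left_eq := h.right_eq
  right_eq := by simpa using h.left_eq

lemma LapSystem.secondDiff_left {U V : E d → ℝ} {B : E d →L[ℝ] E d} {f g : E d → ℝ}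
    (h : LapSystem U V B f g) (x s : E d) :
    secondDiff f x s = secondDiff U x s + secondDiff (logLap g) (B x) (B s) := by
  simp only [secondDiff, h.left_eq, map_add, map_sub]
  ring

/-- Coordinates adapted to a Schrödinger system: `L` and `M` diagonalize simultaneously, with the
same diagonal `D > 0`, an upper bound on the Hessian of `U` and a lower bound on the Hessian of
`V`, and turn the interaction into `t⁻¹ ⟪L x, M y⟫`. -/
structure Coords (U V : E d → ℝ) (B L M : E d →L[ℝ] E d) (D : Fin d → ℝ) (t : ℝ) : Prop where
  t_pos : 0 < t
  D_pos : ∀ i, 0 < D i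
  surj : Function.Surjective L
  inner_eq : ∀ x y, ⟪B x, y⟫ = t⁻¹ * ∑ i, L x i * M y i
  left_le : ∀ x s, secondDiff U x s ≤ ∑ i, D i * L s i ^ 2
  le_right : ∀ y s, ∑ i, D i * M s i ^ 2 ≤ secondDiff V y s

section Iteration

variable {U V : E d → ℝ} {B L M : E d →L[ℝ] E d} {D : Fin d → ℝ} {t : ℝ} {f g : E d → ℝ}

lemma Coords.le_secondDiff_logLap_left (c : Coords U V B L M D t) (h : LapSystem U V B f g)
    {ρ : ℝ} (hρ : 0 < ρ)
    (H : ∀ x s, secondDiff (logLap g) (B x) (B s) ≤ (t * ρ)⁻¹ * ∑ i, L s i ^ 2) (θ s : E d) :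
    t⁻¹ * ∑ i, M s i ^ 2 / (t * D i + ρ⁻¹) ≤ secondDiff (logLap f) θ (B.adjoint s) := by
  have ht := c.t_pos
  -- The optimal direction in the Cramér–Rao bound.
  obtain ⟨δ, hδ⟩ := c.surj (WithLp.toLp 2 fun i => M s i / (t * D i + ρ⁻¹))
  have hδ' : ∀ i, L δ i = M s i / (t * D i + ρ⁻¹) := fun i => by rw [hδ]
  have key := h.left.le_secondDiff_logLap (δ := δ)
    (G := ∑ i, D i * L δ i ^ 2 + (t * ρ)⁻¹ * ∑ i, L δ i ^ 2)
    (fun x => by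
      rw [h.secondDiff_left]
      exact add_le_add (c.left_le x δ) (H x δ)) θ (B.adjoint s)
  refine le_trans (le_of_eq ?_) key
  rw [ContinuousLinearMap.adjoint_inner_left, real_inner_comm, c.inner_eq]
  simp only [Finset.mul_sum, ← Finset.sum_add_distrib, ← Finset.sum_sub_distrib]
  refine Finset.sum_congr rfl fun i _ => ?_
  rw [hδ']
  have : t * D i + ρ⁻¹ ≠ 0 := by have := c.D_pos i; positivity
  have e : M s i = (t * D i + ρ⁻¹) * (M s i / (t * D i + ρ⁻¹)) := by
    rw [mul_div_cancel₀ _ this]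
  set k := M s i / (t * D i + ρ⁻¹)
  rw [e]
  field_simp
  ring

lemma Coords.secondDiff_logLap_right_le (c : Coords U V B L M D t) (h : LapSystem U V B f g)
    {ρ : ℝ} (hρ : 0 < ρ) (H : ∀ y s, t⁻¹ * ρ * ∑ i, M s i ^ 2 ≤ secondDiff g y s) (θ s : E d) :
    secondDiff (logLap g) θ (B s) ≤ (t * ρ)⁻¹ * ∑ i, L s i ^ 2 := by
  have ht := c.t_pos
  refine h.right.secondDiff_logLap_le H (fun y => ?_) θ
  rw [c.inner_eq]
  simp only [Finset.mul_sum, ← Finset.sum_add_distrib]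
  refine Finset.sum_le_sum fun i _ => ?_
  have : t⁻¹ * ρ * M y i ^ 2 + (t * ρ)⁻¹ * L s i ^ 2 - 2 * (t⁻¹ * (L s i * M y i))
      = (t * ρ)⁻¹ * (ρ * M y i - L s i) ^ 2 := by field_simp; ring
  have : 0 ≤ (t * ρ)⁻¹ * (ρ * M y i - L s i) ^ 2 := by positivity
  linarith

/-- One turn of the Riccati iteration in a single coordinate: below the fixed point `ρ = 1` of the
limiting equation, each turn gains at least a fixed amount. -/
lemma riccati_step {p q ρ : ℝ} (hq : 0 < q) (hqp : q ≤ p) (hρ : 0 < ρ) (hρ1 : ρ ≤ 1) :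
    ρ + q ^ 2 / (1 + q) ≤ p + 1 / (p + ρ⁻¹) := by
  have hp : 0 < p := hq.trans_le hqp
  have h1 : q ^ 2 / (1 + q) ≤ p ^ 2 / (1 + p) := by
    rw [div_le_div_iff₀ (by positivity) (by positivity)]
    nlinarith [mul_nonneg hq.le (mul_nonneg hp.le (sub_nonneg.2 hqp))]
  have h2 : p + 1 / (p + ρ⁻¹) - ρ - p ^ 2 / (1 + p)
      = p * (1 + p * ρ - ρ ^ 2 * (1 + p)) / ((1 + p * ρ) * (1 + p)) := by
    field_simp
    ring
  have h3 : 0 ≤ 1 + p * ρ - ρ ^ 2 * (1 + p) := by nlinarith [mul_pos hp hρ]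
  have h4 : 0 ≤ p * (1 + p * ρ - ρ ^ 2 * (1 + p)) / ((1 + p * ρ) * (1 + p)) := by positivity
  linarith

/-- The bound given by the limiting Riccati equation holds for every `t > 0`, not only
asymptotically: starting from the a priori bound given by the convexity of `V`, the iteration of
the two one-sided bounds passes the value `ρ = 1` after finitely many turns. -/
lemma Coords.secondDiff_logLap_right_le_sum (c : Coords U V B L M D t)
    (h : LapSystem U V B f g) (x s : E d) :
    secondDiff (logLap g) (B x) (B s) ≤ t⁻¹ * ∑ i, L s i ^ 2 := by
  have ht := c.t_pos
  obtain ⟨m, hm, hmD⟩ : ∃ m : ℝ, 0 < m ∧ ∀ i, m ≤ D i := by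
    rcases isEmpty_or_nonempty (Fin d) with h0 | h0
    · exact ⟨1, one_pos, fun i => h0.elim i⟩
    · obtain ⟨i, hi⟩ := Finite.exists_min D
      exact ⟨D i, c.D_pos i, hi⟩
  set q := t * m
  have hq : 0 < q := by positivity
  set κ := q ^ 2 / (1 + q)
  have hκ : 0 < κ := by positivity
  have hg := h.swap.secondDiff_left
  -- The bound after `n` turns; `q = t m` is the a priori bound, from the convexity of `V` alone.
  have main : ∀ n : ℕ, ∀ y s, t⁻¹ * min 1 (q + n * κ) * ∑ i, M s i ^ 2 ≤ secondDiff g y s := by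
    intro n
    induction n with
    | zero =>
      intro y s
      have h0 := h.left.le_secondDiff_logLap (δ := 0) (G := 0)
        (fun x => by simp only [secondDiff, add_zero, sub_zero]; linarith) (B.adjoint y)
        (B.adjoint s)
      rw [inner_zero_right] at h0
      have h1 : t⁻¹ * min 1 (q + (0 : ℕ) * κ) * ∑ i, M s i ^ 2 ≤ ∑ i, D i * M s i ^ 2 := by
        rw [Finset.mul_sum]
        refine Finset.sum_le_sum fun i _ => mul_le_mul_of_nonneg_right ?_ (sq_nonneg _)
        calc t⁻¹ * min 1 (q + (0 : ℕ) * κ) ≤ t⁻¹ * q := by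
              gcongr; exact (min_le_right _ _).trans (by simp)
          _ = m := by simp only [q]; field_simp
          _ ≤ D i := hmD i
      rw [hg]
      linarith [c.le_right y s]
    | succ n ih =>
      intro y s
      set ρ := min 1 (q + n * κ)
      have hρ : 0 < ρ := lt_min one_pos (by positivity)
      have h1 := c.le_secondDiff_logLap_left h hρ
        (fun x s => c.secondDiff_logLap_right_le h hρ ih (B x) s) (B.adjoint y) s
      rw [hg]
      refine le_trans ?_ (add_le_add (c.le_right y s) h1)
      simp only [Finset.mul_sum, ← Finset.sum_add_distrib]
      refine Finset.sum_le_sum fun i _ => ?_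
      have h2 : min 1 (q + (n + 1 : ℕ) * κ) ≤ ρ + κ := by
        simp only [ρ]
        rcases le_total 1 (q + n * κ) with h3 | h3
        · rw [min_eq_left h3]; exact (min_le_left _ _).trans (by linarith)
        · rw [min_eq_right h3]; exact (min_le_right _ _).trans (by push_cast; linarith)
      have h4 := riccati_step (p := t * D i) hq
        (mul_le_mul_of_nonneg_left (hmD i) ht.le) hρ (min_le_left _ _)
      calc t⁻¹ * min 1 (q + (n + 1 : ℕ) * κ) * M s i ^ 2
          ≤ t⁻¹ * (t * D i + 1 / (t * D i + ρ⁻¹)) * M s i ^ 2 := by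
            gcongr
            exact h2.trans h4
        _ = D i * M s i ^ 2 + t⁻¹ * (M s i ^ 2 / (t * D i + ρ⁻¹)) := by
            field_simp
  obtain ⟨n, hn⟩ := exists_nat_gt (1 / κ)
  have hn1 : min 1 (q + n * κ) = 1 := by
    rw [div_lt_iff₀ hκ] at hn
    exact min_eq_left (by linarith)
  have := c.secondDiff_logLap_right_le h one_pos (by simpa [hn1] using main n) (B x) s
  simpa using this

lemma Coords.sum_le_secondDiff_logLap_left (c : Coords U V B L M D t)
    (h : LapSystem U V B f g) (θ s : E d) :
    t⁻¹ * ∑ i, M s i ^ 2 / (t * D i + 1) ≤ secondDiff (logLap f) θ (B.adjoint s) := by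
  simpa using c.le_secondDiff_logLap_left h one_pos
    (by simpa using c.secondDiff_logLap_right_le_sum h) θ s

end Iteration

/-! ### Differentiability of Laplace transforms -/

/-- The mean of the probability measure proportional to `e^{-f(y) + ⟪θ, y⟫} dy`. -/
def tiltedMean {d : ℕ} (f : E d → ℝ) (θ : E d) : E d :=
  (lap f θ)⁻¹ • ∫ y, Real.exp (-f y + ⟪θ, y⟫) • y

lemma exp_mul_norm_le {c : ℝ} (hc : 0 ≤ c) (y : E d) :
    Real.exp (c * ‖y‖) ≤ 1 + ∑ i, (Real.exp (c * d * y i) + Real.exp (-(c * d * y i))) := by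
  rcases isEmpty_or_nonempty (Fin d) with h0 | h0
  · have : y = 0 := Subsingleton.elim _ _
    simp [this]
  obtain ⟨i, hi⟩ := Finite.exists_max fun i => |y i|
  have hn : ‖y‖ ≤ d * |y i| := by
    refine abs_le_of_sq_le_sq' ?_ (by positivity) |>.2
    rw [EuclideanSpace.real_norm_sq_eq]
    have hd : (1 : ℝ) ≤ d := by
      have := Fin.pos_iff_nonempty.2 h0
      exact_mod_cast this
    calc ∑ j, y j ^ 2 ≤ ∑ _j : Fin d, |y i| ^ 2 :=
          Finset.sum_le_sum fun j _ => by
            rw [← sq_abs (y j)]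
            exact pow_le_pow_left₀ (abs_nonneg _) (hi j) 2
      _ = d * |y i| ^ 2 := by simp
      _ ≤ (d * |y i|) ^ 2 := by
          rw [mul_pow]; gcongr; nlinarith
  calc Real.exp (c * ‖y‖) ≤ Real.exp (|c * d * y i|) := by
        rw [abs_mul, abs_of_nonneg (by positivity : 0 ≤ c * d), mul_assoc]
        gcongr
    _ ≤ Real.exp (c * d * y i) + Real.exp (-(c * d * y i)) := by
        rcases abs_cases (c * d * y i) with h | h <;> rw [h.1] <;>
          linarith [Real.exp_pos (c * d * y i), Real.exp_pos (-(c * d * y i))]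
    _ ≤ ∑ i, (Real.exp (c * d * y i) + Real.exp (-(c * d * y i))) :=
        Finset.single_le_sum (f := fun i => Real.exp (c * d * y i) + Real.exp (-(c * d * y i)))
          (fun _ _ => by positivity) (Finset.mem_univ i)
    _ ≤ _ := by linarith

lemma LapFinite.integrable_exp_norm {f : E d → ℝ} (hf : LapFinite f) (θ : E d) {c : ℝ}
    (hc : 0 ≤ c) : Integrable fun y => Real.exp (-f y + ⟪θ, y⟫) * Real.exp (c * ‖y‖) := by
  have hm := hf.measurable
  have h1 : Integrable fun y => Real.exp (-f y + ⟪θ, y⟫) *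
      (1 + ∑ i, (Real.exp (c * d * y i) + Real.exp (-(c * d * y i)))) := by
    simp only [mul_add, mul_one, Finset.mul_sum]
    refine (hf.integrable θ).add (integrable_finsetSum _ fun i _ => ?_)
    have e : ∀ a : ℝ, (fun y : E d => Real.exp (-f y + ⟪θ, y⟫) * Real.exp (a * y i))
        = fun y => Real.exp (-f y + ⟪θ + EuclideanSpace.single i a, y⟫) := fun a => by
      ext y
      rw [← Real.exp_add, inner_add_left, EuclideanSpace.inner_single_left]
      simp [add_assoc]
    refine Integrable.add ?_ ?_
    · rw [e]; exact hf.integrable _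
    · simp only [← neg_mul]
      rw [e]; exact hf.integrable _
  refine h1.mono' (by fun_prop) (.of_forall fun y => ?_)
  rw [Real.norm_of_nonneg (by positivity)]
  gcongr
  exact exp_mul_norm_le hc y

section

variable {G : Type*} [NormedAddCommGroup G] [NormedSpace ℝ G]

lemma LapFinite.integrable_smul {f : E d → ℝ} (hf : LapFinite f) (θ : E d) {Φ : E d → G}
    (hΦ : AEStronglyMeasurable Φ volume) (hb : ∀ y, ‖Φ y‖ ≤ Real.exp ‖y‖) :
    Integrable fun y => Real.exp (-f y + ⟪θ, y⟫) • Φ y := by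
  have hm := hf.measurable
  refine (hf.integrable_exp_norm θ one_pos.le).mono' ?_ (.of_forall fun y => ?_)
  · exact AEStronglyMeasurable.smul (by fun_prop) hΦ
  · rw [norm_smul, Real.norm_of_nonneg (by positivity), one_mul]
    gcongr
    exact hb y

lemma LapFinite.integrable_smulRight {f : E d → ℝ} (hf : LapFinite f) (θ : E d) {Φ : E d → G}
    (hΦ : AEStronglyMeasurable Φ volume) (hb : ∀ y, ‖Φ y‖ ≤ Real.exp ‖y‖) :
    Integrable fun y => Real.exp (-f y + ⟪θ, y⟫) • (innerSL ℝ y).smulRight (Φ y) := by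
  have hm := hf.measurable
  refine (hf.integrable_exp_norm θ two_pos.le).mono' ?_ (.of_forall fun y => ?_)
  · have he : AEStronglyMeasurable (fun y => Real.exp (-f y + ⟪θ, y⟫)) volume := by fun_prop
    refine he.smul ?_
    exact (ContinuousLinearMap.smulRightL ℝ (E d) G).aestronglyMeasurable_comp₂
      (innerSL ℝ).continuous.aestronglyMeasurable hΦ
  · rw [norm_smul, Real.norm_of_nonneg (by positivity), ContinuousLinearMap.norm_smulRight_apply,
      innerSL_apply_norm, two_mul, Real.exp_add ‖y‖]
    refine mul_le_mul_of_nonneg_left (mul_le_mul ?_ (hb y) (norm_nonneg _) (Real.exp_nonneg _))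
      (Real.exp_nonneg _)
    exact (Real.add_one_le_exp _).trans' (by linarith)

/-- Differentiation under the integral sign. On the unit ball around `θ` the derivative of the
integrand is dominated by `e^{-f(y) + ⟪θ, y⟫ + 3‖y‖}`. -/
lemma LapFinite.hasFDerivAt_integral {f : E d → ℝ} (hf : LapFinite f) (θ : E d) {Φ : E d → G}
    (hΦ : AEStronglyMeasurable Φ volume) (hb : ∀ y, ‖Φ y‖ ≤ Real.exp ‖y‖) :
    HasFDerivAt (fun θ => ∫ y, Real.exp (-f y + ⟪θ, y⟫) • Φ y)
      (∫ y, Real.exp (-f y + ⟪θ, y⟫) • (innerSL ℝ y).smulRight (Φ y)) θ := by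
  have hm := hf.measurable
  refine hasFDerivAt_integral_of_dominated_of_fderiv_le (Metric.ball_mem_nhds θ one_pos)
    (F' := fun θ y => Real.exp (-f y + ⟪θ, y⟫) • (innerSL ℝ y).smulRight (Φ y))
    (bound := fun y => Real.exp (-f y + ⟪θ, y⟫) * Real.exp (3 * ‖y‖))
    (.of_forall fun θ => (hf.integrable_smul θ hΦ hb).aestronglyMeasurable)
    (hf.integrable_smul θ hΦ hb) (hf.integrable_smulRight θ hΦ hb).aestronglyMeasurable ?_
    (hf.integrable_exp_norm θ (by norm_num)) ?_
  · refine .of_forall fun y θ' hθ' => ?_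
    rw [norm_smul, Real.norm_of_nonneg (by positivity), ContinuousLinearMap.norm_smulRight_apply,
      innerSL_apply_norm]
    have h1 : ⟪θ', y⟫ ≤ ⟪θ, y⟫ + ‖y‖ := by
      have h2 : ⟪θ' - θ, y⟫ ≤ ‖θ' - θ‖ * ‖y‖ := real_inner_le_norm _ _
      have h3 : ‖θ' - θ‖ < 1 := by rwa [← dist_eq_norm]
      rw [inner_sub_left] at h2
      nlinarith [norm_nonneg y]
    calc Real.exp (-f y + ⟪θ', y⟫) * (‖y‖ * ‖Φ y‖)
        ≤ Real.exp (-f y + (⟪θ, y⟫ + ‖y‖)) * (Real.exp ‖y‖ * Real.exp ‖y‖) := by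
          gcongr
          · exact (Real.add_one_le_exp _).trans' (by linarith)
          · exact hb y
      _ = _ := by simp only [← Real.exp_add]; congr 1; ring
  · refine .of_forall fun y θ' _ => ?_
    have h1 : HasFDerivAt (fun θ : E d => -f y + ⟪θ, y⟫) (innerSL ℝ y) θ' := by
      have e : (fun θ : E d => -f y + ⟪θ, y⟫) = fun θ => -f y + innerSL ℝ y θ := by
        ext θ; rw [innerSL_apply_apply, real_inner_comm]
      rw [e]
      exact (innerSL ℝ y).hasFDerivAt.const_add _
    refine ((h1.exp).smul_const (Φ y)).congr_fderiv ?_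
    ext s
    simp [mul_smul]

end

lemma LapFinite.hasFDerivAt_lap {f : E d → ℝ} (hf : LapFinite f) (θ : E d) :
    HasFDerivAt (lap f) (lap f θ • innerSL ℝ (tiltedMean f θ)) θ := by
  have h := hf.hasFDerivAt_integral θ (Φ := fun _ => (1 : ℝ)) (by fun_prop)
    (fun y => by simp)
  have hN : Integrable fun y => Real.exp (-f y + ⟪θ, y⟫) • y :=
    hf.integrable_smul θ (by fun_prop) fun y => (Real.add_one_le_exp _).trans' (by linarith)
  have e : lap f = fun θ => ∫ y, Real.exp (-f y + ⟪θ, y⟫) • (1 : ℝ) := by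
    ext θ; simp only [smul_eq_mul, mul_one]; rfl
  refine HasFDerivAt.congr_fderiv (e ▸ h) ?_
  · ext s
    rw [ContinuousLinearMap.integral_apply
      (hf.integrable_smulRight θ aestronglyMeasurable_const (by simp))]
    simp only [tiltedMean, FunLike.coe_smul, Pi.smul_apply, innerSL_apply_apply,
      inner_smul_left, smul_eq_mul, ContinuousLinearMap.smulRight_apply, mul_one]
    rw [real_inner_comm, ← integral_inner hN]
    simp only [inner_smul_right, real_inner_comm, RCLike.conj_to_real]
    rw [mul_inv_cancel_left₀ (hf.lap_pos θ).ne']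

lemma LapFinite.hasFDerivAt_logLap {f : E d → ℝ} (hf : LapFinite f) (θ : E d) :
    HasFDerivAt (logLap f) (innerSL ℝ (tiltedMean f θ)) θ := by
  have := (hf.hasFDerivAt_lap θ).log (hf.lap_pos θ).ne'
  rwa [smul_smul, inv_mul_cancel₀ (hf.lap_pos θ).ne', one_smul] at this

/-- The derivative of the tilted mean is a covariance, hence self-adjoint. -/
lemma LapFinite.exists_hasFDerivAt_tiltedMean {f : E d → ℝ} (hf : LapFinite f) (θ : E d) :
    ∃ C : E d →L[ℝ] E d, HasFDerivAt (tiltedMean f) C θ ∧ ∀ r s, ⟪C r, s⟫ = ⟪C s, r⟫ := by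
  have hb : ∀ y : E d, ‖y‖ ≤ Real.exp ‖y‖ := fun y =>
    (Real.add_one_le_exp _).trans' (by linarith)
  have hI := hf.integrable_smulRight θ (Φ := fun y : E d => y) (by fun_prop) hb
  have h1 := hf.hasFDerivAt_integral θ (Φ := fun y : E d => y) (by fun_prop) hb
  have h2 := (hasDerivAt_inv (hf.lap_pos θ).ne').comp_hasFDerivAt θ (hf.hasFDerivAt_lap θ)
  refine ⟨_, h2.smul h1, fun r s => ?_⟩
  have h3 : ∀ r s : E d, ⟪(∫ y, Real.exp (-f y + ⟪θ, y⟫) • (innerSL ℝ y).smulRight y) r, s⟫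
      = ∫ y, Real.exp (-f y + ⟪θ, y⟫) * (⟪y, r⟫ * ⟪y, s⟫) := by
    intro r s
    rw [ContinuousLinearMap.integral_apply hI, real_inner_comm,
      ← integral_inner (hI.apply_continuousLinearMap r)]
    refine integral_congr_ae (.of_forall fun y => ?_)
    simp [inner_smul_right, real_inner_comm]
  have h4 : (∫ y, Real.exp (-f y + ⟪θ, y⟫) • y) = lap f θ • tiltedMean f θ := by
    rw [tiltedMean, smul_inv_smul₀ (hf.lap_pos θ).ne']
  simp only [add_apply, FunLike.coe_smul, Pi.smul_apply, ContinuousLinearMap.smulRight_apply,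
    inner_add_left, inner_smul_left, h3, h4, innerSL_apply_apply, Function.comp_apply,
    smul_eq_mul, RCLike.conj_to_real, mul_comm ⟪_, r⟫ ⟪_, s⟫]
  ring

/-! ### Second differences and second derivatives -/

/-- If `k` is the second derivative of `g` at `0` and the second differences of `g` at `0` are at
most `c r²`, then `k ≤ c`; otherwise the even function `g(r) + g(-r) - 2g(0) - c r²` would have
both a maximum and, by the second-derivative test, a minimum at `0`. -/
lemma deriv2_le_of_secondDiff_le {g g' : ℝ → ℝ} {k c : ℝ} (hg : ∀ r, HasDerivAt g (g' r) r)
    (hg' : HasDerivAt g' k 0) (h : ∀ r, g r + g (-r) - 2 * g 0 ≤ r ^ 2 * c) : k ≤ c := by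
  by_contra! hk
  set H : ℝ → ℝ := fun r => g r + g (-r) - 2 * g 0 - r ^ 2 * c
  have hneg : ∀ r, HasDerivAt (fun r => g (-r)) (-g' (-r)) r := fun r => by
    have := (hg (-r)).scomp r (hasDerivAt_neg r)
    exact this.congr_deriv (by simp)
  have hH : ∀ r, HasDerivAt H (g' r - g' (-r) - 2 * r * c) r := fun r => by
    have := (((hg r).add (hneg r)).sub_const (2 * g 0)).sub ((hasDerivAt_pow 2 r).mul_const c)
    exact this.congr_deriv (by simp; ring)
  have hH' : HasDerivAt (fun r => g' r - g' (-r) - 2 * r * c) (2 * k - 2 * c) 0 := by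
    have h1 : HasDerivAt (fun r => g' (-r)) (-k) 0 := by
      have h2 : HasDerivAt g' k (-(0 : ℝ)) := by simpa using hg'
      exact (h2.scomp (0 : ℝ) (hasDerivAt_neg 0)).congr_deriv (by simp)
    have := (hg'.sub h1).sub (((hasDerivAt_id (0 : ℝ)).const_mul 2).mul_const c)
    exact this.congr_deriv (by ring)
  have hd : deriv H = fun r => g' r - g' (-r) - 2 * r * c := funext fun r => (hH r).deriv
  have hmin : IsLocalMin H 0 := by
    refine isLocalMin_of_deriv_deriv_pos ?_ ?_ (hH 0).continuousAt
    · rw [hd, hH'.deriv]; linarith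
    · rw [hd]; simp
  have h0 : H 0 = 0 := by simp [H]; ring
  have hz : H =ᶠ[𝓝 0] fun _ => 0 := by
    filter_upwards [hmin] with r hr
    exact le_antisymm (by have := h r; simp only [H]; linarith) (h0 ▸ hr)
  have : deriv (deriv H) 0 = 0 := by
    have h1 : deriv H =ᶠ[𝓝 0] deriv fun _ => (0 : ℝ) := hz.deriv
    rw [h1.deriv_eq]; simp
  rw [hd, hH'.deriv] at this
  linarith

lemma LapFinite.inner_le_of_secondDiff_le {f : E d → ℝ} (hf : LapFinite f) {θ s : E d}
    {C : E d →L[ℝ] E d} (hC : HasFDerivAt (tiltedMean f) C θ) {c : ℝ}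
    (h : ∀ r : ℝ, secondDiff (logLap f) θ (r • s) ≤ r ^ 2 * c) : ⟪C s, s⟫ ≤ c := by
  have hl : ∀ r : ℝ, HasDerivAt (fun r : ℝ => θ + r • s) s r := fun r => by
    simpa using ((hasDerivAt_id r).smul_const s).const_add θ
  refine deriv2_le_of_secondDiff_le (g := fun r => logLap f (θ + r • s))
    (g' := fun r => ⟪tiltedMean f (θ + r • s), s⟫) (fun r => ?_) ?_ (fun r => ?_)
  · exact (hf.hasFDerivAt_logLap _).comp_hasDerivAt r (hl r)
  · have hC' : HasFDerivAt (tiltedMean f) C (θ + (0 : ℝ) • s) := by simpa using hC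
    have := (hC'.comp_hasDerivAt (0 : ℝ) (hl 0)).inner ℝ (hasDerivAt_const (0 : ℝ) s)
    simpa using this
  · simpa [secondDiff, sub_eq_add_neg] using h r

lemma LapFinite.le_inner_of_le_secondDiff {f : E d → ℝ} (hf : LapFinite f) {θ s : E d}
    {C : E d →L[ℝ] E d} (hC : HasFDerivAt (tiltedMean f) C θ) {c : ℝ}
    (h : ∀ r : ℝ, r ^ 2 * c ≤ secondDiff (logLap f) θ (r • s)) : c ≤ ⟪C s, s⟫ := by
  have hl : ∀ r : ℝ, HasDerivAt (fun r : ℝ => θ + r • s) s r := fun r => by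
    simpa using ((hasDerivAt_id r).smul_const s).const_add θ
  refine neg_le_neg_iff.1 (deriv2_le_of_secondDiff_le (g := fun r => -logLap f (θ + r • s))
    (g' := fun r => -⟪tiltedMean f (θ + r • s), s⟫) (fun r => ?_) ?_ (fun r => ?_))
  · exact ((hf.hasFDerivAt_logLap _).comp_hasDerivAt r (hl r)).neg
  · have hC' : HasFDerivAt (tiltedMean f) C (θ + (0 : ℝ) • s) := by simpa using hC
    have := (hC'.comp_hasDerivAt (0 : ℝ) (hl 0)).inner ℝ (hasDerivAt_const (0 : ℝ) s)
    exact this.neg.congr_deriv (by simp)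
  · have := h r
    simp only [secondDiff, sub_eq_add_neg, neg_smul, zero_smul, add_zero] at *
    linarith

lemma le_secondDiff_of_le_fderiv {f : E d → ℝ} (hf : ContDiff ℝ 2 f) {s : E d} {q : ℝ}
    (h : ∀ z, q ≤ fderiv ℝ (fderiv ℝ f) z s s) (x : E d) : q ≤ secondDiff f x s := by
  have hl : ∀ r : ℝ, HasDerivAt (fun r : ℝ => x + r • s) s r := fun r => by
    simpa using ((hasDerivAt_id r).smul_const s).const_add x
  have d1 : ∀ r : ℝ, HasDerivAt (fun r : ℝ => f (x + r • s) - q / 2 * r ^ 2)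
      (fderiv ℝ f (x + r • s) s - q * r) r := fun r => by
    have h1 := ((hf.differentiable (by norm_num)) (x + r • s)).hasFDerivAt.comp_hasDerivAt r (hl r)
    exact (h1.sub ((hasDerivAt_pow 2 r).const_mul (q / 2))).congr_deriv (by simp; ring)
  have d2 : ∀ r : ℝ, HasDerivAt (fun r : ℝ => fderiv ℝ f (x + r • s) s - q * r)
      (fderiv ℝ (fderiv ℝ f) (x + r • s) s s - q) r := fun r => by
    have h0 : Differentiable ℝ (fderiv ℝ f) :=
      (hf.fderiv_right (m := 1) (by norm_num)).differentiable (by norm_num)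
    have h1 := (h0 (x + r • s)).hasFDerivAt.comp_hasDerivAt r (hl r)
    have h2 := h1.clm_apply (hasDerivAt_const r s)
    exact (h2.sub ((hasDerivAt_id r).const_mul q)).congr_deriv (by simp)
  have hconv : ConvexOn ℝ Set.univ fun r : ℝ => f (x + r • s) - q / 2 * r ^ 2 :=
    convexOn_of_hasDerivWithinAt2_nonneg convex_univ
      (fun r _ => (d1 r).continuousAt.continuousWithinAt)
      (fun r _ => (d1 r).hasDerivWithinAt) (fun r _ => (d2 r).hasDerivWithinAt)
      (fun r _ => sub_nonneg.2 (h _))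
  have := hconv.2 (Set.mem_univ 1) (Set.mem_univ (-1)) (show (0 : ℝ) ≤ 1 / 2 by norm_num)
    (show (0 : ℝ) ≤ 1 / 2 by norm_num) (by norm_num)
  simp [← sub_eq_add_neg] at this
  unfold secondDiff
  linarith

/-! ### Geometric means of positive definite matrices -/

open scoped MatrixOrder in
lemma msqrt_mul_self {v : Mat d} (hv : v.PosDef) : msqrt v * msqrt v = v :=
  CFC.sqrt_mul_sqrt_self v hv.posSemidef.nonneg

open scoped MatrixOrder in
lemma posDef_msqrt {v : Mat d} (hv : v.PosDef) : (msqrt v).PosDef := by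
  have h : (msqrt v).PosSemidef := Matrix.nonneg_iff_posSemidef.1 (CFC.sqrt_nonneg v)
  rw [h.posDef_iff_det_ne_zero]
  intro h0
  have := congrArg Matrix.det (msqrt_mul_self hv)
  rw [Matrix.det_mul, h0, mul_zero] at this
  exact hv.det_pos.ne this

open scoped MatrixOrder in
lemma msqrt_eq_of_mul_self {v x : Mat d} (hx : x.PosDef) (h : x * x = v) : msqrt v = x :=
  CFC.sqrt_unique h hx.posSemidef.nonneg

lemma posDef_mul_mul_transpose {A B : Mat d} (hA : A.PosDef) (hB : IsUnit B) :
    (B * A * B.transpose).PosDef := by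
  have := (Matrix.IsUnit.posDef_star_right_conjugate_iff (x := A) hB).2 hA
  rwa [Matrix.star_eq_conjTranspose, Matrix.conjTranspose_eq_transpose_of_trivial] at this

lemma posDef_transpose_eq {A : Mat d} (hA : A.PosDef) : A.transpose = A := by
  simpa [Matrix.IsHermitian, Matrix.conjTranspose_eq_transpose_of_trivial] using hA.isHermitian

lemma posDef_mul_mul {A B : Mat d} (hA : A.PosDef) (hB : B.PosDef) : (B * A * B).PosDef := by
  simpa [posDef_transpose_eq hB] using posDef_mul_mul_transpose hA hB.isUnit

lemma posDef_geomMean {u v : Mat d} (hu : u.PosDef) (hv : v.PosDef) : (geomMean u v).PosDef :=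
  posDef_mul_mul (posDef_msqrt (posDef_mul_mul hu (posDef_msqrt hv).inv)) (posDef_msqrt hv)

/-- The geometric mean `G` of `u` and `v` solves the Riccati equation `G v⁻¹ G = u`. -/
lemma geomMean_mul_inv_mul {u v : Mat d} (hu : u.PosDef) (hv : v.PosDef) :
    geomMean u v * v⁻¹ * geomMean u v = u := by
  have hs := msqrt_mul_self (posDef_mul_mul hu (posDef_msqrt hv).inv)
  have hr := (posDef_msqrt hv).det_pos.ne'.isUnit
  have hv2 := congrArg (·⁻¹) (msqrt_mul_self hv)
  simp only [Matrix.mul_inv_rev] at hv2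
  unfold geomMean
  set r := msqrt v
  set m := msqrt (r⁻¹ * u * r⁻¹)
  rw [← hv2]
  calc r * m * r * (r⁻¹ * r⁻¹) * (r * m * r) = r * m * (r * r⁻¹) * (r⁻¹ * r) * m * r := by
        simp only [Matrix.mul_assoc]
    _ = r * (m * m) * r := by
        rw [Matrix.mul_nonsing_inv _ hr, Matrix.nonsing_inv_mul _ hr]
        simp only [Matrix.mul_one, Matrix.mul_assoc]
    _ = (r * r⁻¹) * u * (r⁻¹ * r) := by rw [hs]; simp only [Matrix.mul_assoc]
    _ = u := by rw [Matrix.mul_nonsing_inv _ hr, Matrix.nonsing_inv_mul _ hr]; simp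

/-- The geometric mean is the only positive definite solution of `X v⁻¹ X = u`. -/
lemma eq_geomMean_of_mul_inv_mul {u v X : Mat d} (hv : v.PosDef)
    (hX : X.PosDef) (h : X * v⁻¹ * X = u) : X = geomMean u v := by
  have hr := (posDef_msqrt hv).det_pos.ne'.isUnit
  have hv2 := congrArg (·⁻¹) (msqrt_mul_self hv)
  simp only [Matrix.mul_inv_rev] at hv2
  have hp := posDef_mul_mul hX (posDef_msqrt hv).inv
  unfold geomMean
  set r := msqrt v
  rw [msqrt_eq_of_mul_self hp]
  · calc X = (r * r⁻¹) * X * (r⁻¹ * r) := by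
          rw [Matrix.mul_nonsing_inv _ hr, Matrix.nonsing_inv_mul _ hr]; simp
      _ = _ := by simp only [Matrix.mul_assoc]
  · rw [← h, ← hv2]; simp only [Matrix.mul_assoc]

lemma isUnit_det_of_posDef {A : Mat d} (hA : A.PosDef) : IsUnit A.det := hA.det_pos.ne'.isUnit

lemma inv_mul_mul_inv_of_mul_inv_mul {A G u : Mat d} (hu : u.PosDef) (hA : A.PosDef)
    (h : G * u⁻¹ * G = A⁻¹) : G⁻¹ * u * G⁻¹ = A := by
  have := congrArg (·⁻¹) h
  simp only [Matrix.mul_inv_rev, Matrix.nonsing_inv_nonsing_inv _ (isUnit_det_of_posDef hu),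
    Matrix.nonsing_inv_nonsing_inv _ (isUnit_det_of_posDef hA)] at this
  rw [← this, Matrix.mul_assoc]

/-- The limiting bounds on the forward and backward maps are governed by mutually inverse
matrices. -/
lemma mul_geomMean_mul_transpose {u v χ : Mat d} (hu : u.PosDef) (hv : v.PosDef)
    (hχ : IsUnit χ.det) :
    χ * geomMean (χ.transpose * v * χ)⁻¹ u * χ.transpose
      = (geomMean (χ * u * χ.transpose)⁻¹ v)⁻¹ := by
  have hχ' : IsUnit χ.transpose.det := by rwa [Matrix.det_transpose]
  have hχu : IsUnit χ := (Matrix.isUnit_iff_isUnit_det _).2 hχ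
  have hχu' : IsUnit χ.transpose := (Matrix.isUnit_iff_isUnit_det _).2 hχ'
  have hA : (χ.transpose * v * χ).PosDef := by
    simpa using posDef_mul_mul_transpose hv hχu'
  have hG := posDef_geomMean hA.inv hu
  have hR := geomMean_mul_inv_mul hA.inv hu
  set G := geomMean (χ.transpose * v * χ)⁻¹ u
  have hX : (χ * G * χ.transpose).PosDef := posDef_mul_mul_transpose hG hχu
  have hR2 := inv_mul_mul_inv_of_mul_inv_mul hu hA hR
  rw [← eq_geomMean_of_mul_inv_mul hv hX.inv, Matrix.nonsing_inv_nonsing_inv _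
    (isUnit_det_of_posDef hX)]
  simp only [Matrix.mul_inv_rev]
  have hGu := isUnit_det_of_posDef hG
  have hvu := isUnit_det_of_posDef hv
  -- `u⁻¹ = G⁻¹ (χᵀ v χ)⁻¹ G⁻¹` by the Riccati equation.
  have hui : u⁻¹ = G⁻¹ * (χ⁻¹ * (v⁻¹ * χ.transpose⁻¹)) * G⁻¹ := by
    have : u = G * (χ.transpose * v * χ) * G := by
      rw [← hR2]
      calc u = (G * G⁻¹) * u * (G⁻¹ * G) := by
            rw [Matrix.mul_nonsing_inv _ hGu, Matrix.nonsing_inv_mul _ hGu]; simp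
        _ = _ := by simp only [Matrix.mul_assoc]
    conv_lhs => rw [this]
    simp only [Matrix.mul_inv_rev, Matrix.mul_assoc]
  rw [hui]
  simp only [Matrix.mul_assoc]

/-- Coordinates in which the geometric mean `G` is the identity while `w` and `v⁻¹` become the same
diagonal matrix `D`. -/
lemma exists_diagonalization_geomMean {w v : Mat d} (hw : w.PosDef) (hv : v.PosDef) :
    ∃ (P : Mat d) (D : Fin d → ℝ), IsUnit P.det ∧ (∀ i, 0 < D i) ∧
      geomMean w v = P * P.transpose ∧ w = P * Matrix.diagonal D * P.transpose ∧
      v⁻¹ = P⁻¹.transpose * Matrix.diagonal D * P⁻¹ := by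
  have hG := posDef_geomMean hw hv
  have hR := geomMean_mul_inv_mul hw hv
  set G := geomMean w v
  have hr := posDef_msqrt hG
  have hrr := msqrt_mul_self hG
  set r := msqrt G
  have hru := isUnit_det_of_posDef hr
  have ha := posDef_mul_mul hw hr.inv
  set a := r⁻¹ * w * r⁻¹ with haa
  set O : Mat d := (ha.isHermitian.eigenvectorUnitary : Mat d)
  have hO : O * O.transpose = 1 := by
    have := Unitary.mul_star_self_of_mem ha.isHermitian.eigenvectorUnitary.2
    rwa [Matrix.star_eq_conjTranspose, Matrix.conjTranspose_eq_transpose_of_trivial] at this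
  have hsp : a = O * Matrix.diagonal ha.isHermitian.eigenvalues * O.transpose := by
    have := ha.isHermitian.spectral_theorem
    rwa [Unitary.conjStarAlgAut_apply, Matrix.star_eq_conjTranspose,
      Matrix.conjTranspose_eq_transpose_of_trivial] at this
  set D := ha.isHermitian.eigenvalues
  have hP : IsUnit (r * O).det := by
    rw [Matrix.det_mul]
    exact hru.mul (Matrix.isUnit_det_of_right_inverse hO)
  have hwP : w = r * O * Matrix.diagonal D * (r * O).transpose := by
    rw [Matrix.transpose_mul, posDef_transpose_eq hr]
    calc w = (r * r⁻¹) * w * (r⁻¹ * r) := by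
          rw [Matrix.mul_nonsing_inv _ hru, Matrix.nonsing_inv_mul _ hru]; simp
      _ = r * a * r := by rw [haa]; simp only [Matrix.mul_assoc]
      _ = _ := by rw [hsp]; simp only [Matrix.mul_assoc]
  have hGP : G = r * O * (r * O).transpose := by
    rw [Matrix.transpose_mul, posDef_transpose_eq hr, ← hrr]
    calc r * r = r * (O * O.transpose) * r := by rw [hO]; simp
      _ = _ := by simp only [Matrix.mul_assoc]
  refine ⟨r * O, D, hP, ha.eigenvalues_pos, hGP, hwP, ?_⟩
  set P := r * O
  have hPt : IsUnit P.transpose.det := by rwa [Matrix.det_transpose]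
  have hGu := isUnit_det_of_posDef hG
  calc v⁻¹ = (G⁻¹ * G) * v⁻¹ * (G * G⁻¹) := by
        rw [Matrix.mul_nonsing_inv _ hGu, Matrix.nonsing_inv_mul _ hGu]; simp
    _ = G⁻¹ * (G * v⁻¹ * G) * G⁻¹ := by simp only [Matrix.mul_assoc]
    _ = (P.transpose⁻¹ * P⁻¹) * (P * Matrix.diagonal D * P.transpose)
          * (P.transpose⁻¹ * P⁻¹) := by
        rw [hR, hwP, hGP, Matrix.mul_inv_rev]
    _ = P.transpose⁻¹ * (P⁻¹ * P) * Matrix.diagonal D * (P.transpose * P.transpose⁻¹) * P⁻¹ := by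
        simp only [Matrix.mul_assoc]
    _ = _ := by
        rw [Matrix.nonsing_inv_mul _ hP, Matrix.mul_nonsing_inv _ hPt, Matrix.transpose_nonsing_inv]
        simp

/-! ### Extremal eigenvalues and asymptotic comparison -/

lemma spectrum_nonempty [Nonempty (Fin d)] {A : Mat d} (hA : A.IsHermitian) :
    (spectrum ℝ A).Nonempty := by
  rw [hA.spectrum_real_eq_range_eigenvalues]; exact Set.range_nonempty _

lemma spectrum_finite {A : Mat d} (hA : A.IsHermitian) : (spectrum ℝ A).Finite := by
  rw [hA.spectrum_real_eq_range_eigenvalues]; exact Set.finite_range _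

open scoped MatrixOrder in
lemma LoewnerLE.ellMax_le {A M : Mat d} (hA : A.IsHermitian) (hM : M.IsHermitian)
    (h : LoewnerLE A M) : ellMax A ≤ ellMax M := by
  rcases isEmpty_or_nonempty (Fin d) with h0 | h0
  · exact (congrArg ellMax (Subsingleton.elim A M)).le
  have h1 : M ≤ algebraMap ℝ (Mat d) (ellMax M) :=
    (le_algebraMap_iff_spectrum_le (ha := hM)).2
      fun x hx => le_csSup (spectrum_finite hM).bddAbove hx
  have h2 : A ≤ M := h
  exact csSup_le (spectrum_nonempty hA)
    ((le_algebraMap_iff_spectrum_le (ha := hA)).1 (h2.trans h1))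

open scoped MatrixOrder in
lemma LoewnerLE.ellMin_le {A M : Mat d} (hA : A.IsHermitian) (hM : M.IsHermitian) {ε : ℝ}
    (hε : 0 ≤ ε) (h : LoewnerLE (M - ε • (1 : Mat d)) A) : ellMin M - ε ≤ ellMin A := by
  rcases isEmpty_or_nonempty (Fin d) with h0 | h0
  · rw [Subsingleton.elim A M]; linarith
  have h1 : algebraMap ℝ (Mat d) (ellMin M) ≤ M :=
    (algebraMap_le_iff_le_spectrum (ha := hM)).2
      fun x hx => csInf_le (spectrum_finite hM).bddBelow hx
  have h2 : M - ε • (1 : Mat d) ≤ A := h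
  have h3 : algebraMap ℝ (Mat d) (ellMin M - ε) ≤ A := by
    rw [map_sub, Algebra.algebraMap_eq_smul_one ε]
    exact (sub_le_sub_right h1 _).trans h2
  exact le_csInf (spectrum_nonempty hA) ((algebraMap_le_iff_le_spectrum (ha := hA)).1 h3)

/-- The quadratic form of a matrix. -/
def quad {d : ℕ} (A : Mat d) (x : E d) : ℝ := x.ofLp ⬝ᵥ A.mulVec x.ofLp

lemma loewnerLE_iff {A M : Mat d} (hA : A.IsSymm) (hM : M.IsSymm) :
    LoewnerLE A M ↔ ∀ x, quad A x ≤ quad M x := by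
  have hs : (M - A).IsHermitian := by
    rw [Matrix.IsHermitian, Matrix.conjTranspose_eq_transpose_of_trivial, Matrix.transpose_sub,
      hA.eq, hM.eq]
  rw [LoewnerLE, Matrix.posSemidef_iff_dotProduct_mulVec, and_iff_right hs]
  simp only [star_trivial, Matrix.sub_mulVec, dotProduct_sub, sub_nonneg]
  exact ⟨fun h x => h x.ofLp, fun h x => h (WithLp.toLp 2 x)⟩

lemma isHermitian_of_isSymm {A : Mat d} (hA : A.IsSymm) : A.IsHermitian := by
  rw [Matrix.IsHermitian, Matrix.conjTranspose_eq_transpose_of_trivial, hA.eq]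

lemma asympUpper_of_quad_le {A : ℝ → Mat d} {M : Mat d} (hA : ∀ t > 0, (A t).IsSymm)
    (hM : M.IsSymm) (h : ∀ t > 0, ∀ x, quad (A t) x ≤ quad M x) : AsympUpper A M := by
  have hL : ∀ t > 0, LoewnerLE (A t) M := fun t ht => (loewnerLE_iff (hA t ht) hM).2 (h t ht)
  refine ⟨limsup_le_of_le (by isBoundedDefault) ?_, fun ε hε => ?_⟩
  · filter_upwards [self_mem_nhdsWithin] with t ht
    exact_mod_cast (hL t ht).ellMax_le (isHermitian_of_isSymm (hA t ht)) (isHermitian_of_isSymm hM)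
  · filter_upwards [self_mem_nhdsWithin] with t ht
    unfold LoewnerLE
    rw [add_sub_right_comm]
    exact (hL t ht).add (Matrix.PosSemidef.one.smul hε.le)

lemma asympLower_of_le_quad {A : ℝ → Mat d} {M : Mat d} (hA : ∀ t > 0, (A t).IsSymm)
    (hM : M.IsSymm) {κ : ℝ} (h : ∀ t > 0, ∀ x, quad M x - t * κ * ‖x‖ ^ 2 ≤ quad (A t) x) :
    AsympLower A M := by
  have hL : ∀ ε : ℝ, 0 < ε → ∀ᶠ t in 𝓝[>] (0 : ℝ), LoewnerLE (M - ε • (1 : Mat d)) (A t) := by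
    intro ε hε
    have ht0 : Tendsto (fun t : ℝ => t * κ) (𝓝[>] 0) (𝓝 0) := by
      have : Tendsto (fun t : ℝ => t * κ) (𝓝 0) (𝓝 (0 * κ)) := tendsto_id.mul_const κ
      simpa using this.mono_left nhdsWithin_le_nhds
    filter_upwards [self_mem_nhdsWithin, ht0.eventually_lt_const hε] with t ht htε
    refine (loewnerLE_iff ?_ (hA t ht)).2 fun x => ?_
    · exact hM.sub (Matrix.isSymm_one.smul ε)
    · refine le_trans ?_ (h t ht x)
      have e : quad (M - ε • (1 : Mat d)) x = quad M x - ε * ‖x‖ ^ 2 := by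
        rw [EuclideanSpace.real_norm_sq_eq]
        simp only [quad, Matrix.sub_mulVec, dotProduct_sub, Matrix.smul_mulVec, dotProduct_smul,
          Matrix.one_mulVec, smul_eq_mul]
        simp only [dotProduct, sq]
      rw [e]
      nlinarith [sq_nonneg ‖x‖]
  refine ⟨?_, hL⟩
  refine EReal.ge_of_forall_gt_iff_ge.1 fun z hz => ?_
  have hz' : z < ellMin M := by exact_mod_cast hz
  refine le_liminf_of_le (by isBoundedDefault) ?_
  filter_upwards [self_mem_nhdsWithin, hL _ (sub_pos.2 hz')] with t ht h1
  have := h1.ellMin_le (isHermitian_of_isSymm (hA t ht)) (isHermitian_of_isSymm hM)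
    (sub_pos.2 hz').le
  rw [sub_sub_cancel] at this
  exact_mod_cast this

/-! ### Matrices as operators on the state space -/

/-- The operator `x ↦ A x` on `ℝ^d`. -/
def clm {d : ℕ} (A : Mat d) : E d →L[ℝ] E d := Matrix.toEuclideanCLM (𝕜 := ℝ) A

lemma ofLp_clm (A : Mat d) (x : E d) : (clm A x).ofLp = A.mulVec x.ofLp := by simp [clm]

lemma adjoint_clm (A : Mat d) : (clm A).adjoint = clm A.transpose := by
  rw [← ContinuousLinearMap.star_eq_adjoint, clm, ← map_star, Matrix.star_eq_conjTranspose,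
    Matrix.conjTranspose_eq_transpose_of_trivial, clm]

lemma clm_mul_apply (A C : Mat d) (x : E d) : clm (A * C) x = clm A (clm C x) := by
  simp [clm]

lemma clm_smul_apply (c : ℝ) (A : Mat d) (x : E d) : clm (c • A) x = c • clm A x := by
  simp [clm]

lemma inner_eq_dotProduct (x y : E d) : ⟪x, y⟫ = x.ofLp ⬝ᵥ y.ofLp := by
  rw [EuclideanSpace.inner_eq_star_dotProduct, star_trivial, dotProduct_comm]

lemma clm_surjective {A : Mat d} (hA : IsUnit A.det) : Function.Surjective (clm A) := fun y =>
  ⟨clm A⁻¹ y, by rw [← clm_mul_apply, Matrix.mul_nonsing_inv _ hA]; simp [clm]⟩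

lemma quad_eq_inner (A : Mat d) (x : E d) : quad A x = ⟪clm A x, x⟫ := by
  rw [inner_eq_dotProduct, ofLp_clm, dotProduct_comm, quad]

lemma quad_transpose_mul_mul (A C : Mat d) (x : E d) :
    quad (C.transpose * A * C) x = quad A (clm C x) := by
  rw [quad_eq_inner, quad_eq_inner, clm_mul_apply, clm_mul_apply, ← adjoint_clm,
    ContinuousLinearMap.adjoint_inner_left]

lemma quad_smul (c : ℝ) (A : Mat d) (x : E d) : quad (c • A) x = c * quad A x := by
  simp [quad, Matrix.smul_mulVec]

lemma quad_diagonal (D : Fin d → ℝ) (x : E d) :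
    quad (Matrix.diagonal D) x = ∑ i, D i * x i ^ 2 := by
  simp only [quad, dotProduct, Matrix.mulVec_diagonal]
  exact Finset.sum_congr rfl fun i _ => by ring

lemma quad_transpose_mul (C : Mat d) (x : E d) :
    quad (C.transpose * C) x = ∑ i, clm C x i ^ 2 := by
  have := quad_transpose_mul_mul (1 : Mat d) C x
  rw [Matrix.mul_one] at this
  rw [this, ← Matrix.diagonal_one, quad_diagonal]
  simp

lemma quad_le_norm (A : Mat d) (x : E d) : quad A x ≤ ‖clm A‖ * ‖x‖ ^ 2 := by
  rw [quad_eq_inner]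
  calc ⟪clm A x, x⟫ ≤ ‖clm A x‖ * ‖x‖ := real_inner_le_norm _ _
    _ ≤ ‖clm A‖ * ‖x‖ * ‖x‖ := by gcongr; exact (clm A).le_opNorm x
    _ = _ := by ring

lemma LoewnerLE.quad_le {A M : Mat d} (h : LoewnerLE A M) (x : E d) : quad A x ≤ quad M x := by
  have := h.dotProduct_mulVec_nonneg x.ofLp
  simp only [star_trivial, Matrix.sub_mulVec, dotProduct_sub, sub_nonneg] at this
  exact this

lemma quad_hessMatrix (f : E d → ℝ) (x s : E d) :
    quad (hessMatrix f x) s = fderiv ℝ (fderiv ℝ f) x s s := by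
  have hs : s = ∑ i, s i • EuclideanSpace.single i (1 : ℝ) := by
    ext j
    simp [Finset.sum_apply, Pi.single_apply]
  conv_rhs => rw [hs]
  simp only [map_sum, map_smul, FunLike.coe_sum, Finset.sum_apply, FunLike.coe_smul,
    Pi.smul_apply, smul_eq_mul]
  simp only [quad, dotProduct, Matrix.mulVec, hessMatrix, Matrix.of_apply, Finset.mul_sum]
  rw [Finset.sum_comm]
  exact Finset.sum_congr rfl fun i _ => Finset.sum_congr rfl fun j _ => by ring

lemma quad_le_secondDiff {f : E d → ℝ} (hf : ContDiff ℝ 2 f) {A : Mat d}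
    (h : ∀ x, LoewnerLE A (hessMatrix f x)) (x s : E d) : quad A s ≤ secondDiff f x s :=
  le_secondDiff_of_le_fderiv hf (fun z => quad_hessMatrix f z s ▸ (h z).quad_le s) x

lemma secondDiff_le_quad {f : E d → ℝ} (hf : ContDiff ℝ 2 f) {A : Mat d}
    (h : ∀ x, LoewnerLE (hessMatrix f x) A) (x s : E d) : secondDiff f x s ≤ quad A s := by
  have e : fderiv ℝ (-f) = -fderiv ℝ f := funext fun z => fderiv_neg
  have := le_secondDiff_of_le_fderiv (f := -f) hf.neg (s := s) (q := -quad A s) (fun z => by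
    rw [e, fderiv_neg]
    simpa [← quad_hessMatrix] using (h z).quad_le s) x
  simp only [secondDiff, Pi.neg_apply] at *
  linarith

/-! ### Entropic maps as tilted means -/

lemma integrable_gibbsKernel_iff {G : Type*} [NormedAddCommGroup G] [NormedSpace ℝ G]
    {W : E d → E d → ℝ} {x : E d} (hW : Measurable (W x)) {F : E d → G} :
    Integrable F (gibbsKernel W x) ↔ Integrable (fun y => Real.exp (-W x y) • F y) := by
  rw [gibbsKernel, integrable_withDensity_iff_integrable_smul' (by fun_prop) (by simp)]
  simp [ENNReal.toReal_ofReal (Real.exp_pos _).le]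

lemma integral_gibbsKernel {G : Type*} [NormedAddCommGroup G] [NormedSpace ℝ G]
    {W : E d → E d → ℝ} {x : E d} (hW : Measurable (W x)) (F : E d → G) :
    ∫ y, F y ∂(gibbsKernel W x) = ∫ y, Real.exp (-W x y) • F y := by
  rw [gibbsKernel, integral_withDensity_eq_integral_toReal_smul (by fun_prop) (by simp)]
  simp [ENNReal.toReal_ofReal (Real.exp_pos _).le]

lemma IsSchrodingerSystem.lapSystem {U V : E d → ℝ} {W : E d → E d → ℝ} {𝕌 𝕍 a b : E d → ℝ}
    (h : IsSchrodingerSystem U V W 𝕌 𝕍) {B : E d →L[ℝ] E d} (ha : Measurable a)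
    (hb : Measurable b) (hW : ∀ x y, W x y = a x + b y - ⟪B x, y⟫)
    (hB : Function.Surjective B) (hB' : Function.Surjective B.adjoint) :
    LapSystem U V B (fun x => 𝕌 x + a x) (fun y => 𝕍 y + b y) := by
  have m1 := h.measurable_left
  have m2 := h.measurable_right
  have hm1 : ∀ x, Measurable (W x) := fun x => by
    have : W x = fun y => a x + b y - ⟪B x, y⟫ := funext (hW x)
    rw [this]; fun_prop
  have hm2 : ∀ y, Measurable (conj W y) := fun y => by
    have : conj W y = fun x => a x + b y - ⟪B x, y⟫ := funext fun x => hW x y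
    rw [this]; fun_prop
  have e1 : ∀ x y, Real.exp (-W x y) • Real.exp (-𝕍 y)
      = Real.exp (-a x) * Real.exp (-(𝕍 y + b y) + ⟪B x, y⟫) := fun x y => by
    rw [smul_eq_mul, ← Real.exp_add, ← Real.exp_add, hW]; congr 1; ring
  have e2 : ∀ y x, Real.exp (-conj W y x) • Real.exp (-𝕌 x)
      = Real.exp (-b y) * Real.exp (-(𝕌 x + a x) + ⟪B.adjoint y, x⟫) := fun y x => by
    rw [smul_eq_mul, ← Real.exp_add, ← Real.exp_add, conj, hW,
      ContinuousLinearMap.adjoint_inner_left, real_inner_comm y]; congr 1; ring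
  have right : LapFinite fun y => 𝕍 y + b y := ⟨by fun_prop, fun θ => by
    obtain ⟨x, rfl⟩ := hB θ
    have := (integrable_gibbsKernel_iff (hm1 x)).1 (h.integrable_right x)
    simp only [e1] at this
    exact (integrable_const_mul_iff (Real.exp_pos _).ne'.isUnit _).1 this⟩
  have left : LapFinite fun x => 𝕌 x + a x := ⟨by fun_prop, fun θ => by
    obtain ⟨y, rfl⟩ := hB' θ
    have := (integrable_gibbsKernel_iff (hm2 y)).1 (h.integrable_left y)
    simp only [e2] at this
    exact (integrable_const_mul_iff (Real.exp_pos _).ne'.isUnit _).1 this⟩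
  refine ⟨left, right, fun x => ?_, fun y => ?_⟩
  · rw [h.left_eq, integral_gibbsKernel (hm1 x)]
    simp only [e1]
    rw [integral_const_mul]
    change U x + Real.log (_ * lap (fun y => 𝕍 y + b y) (B x)) + a x = _
    rw [Real.log_mul (Real.exp_pos _).ne' (right.lap_pos (B x)).ne',
      Real.log_exp]
    simp only [logLap]
    ring
  · rw [h.right_eq, integral_gibbsKernel (hm2 y)]
    simp only [e2]
    rw [integral_const_mul]
    change V y + Real.log (_ * lap (fun x => 𝕌 x + a x) (B.adjoint y)) + b y = _
    rw [Real.log_mul (Real.exp_pos _).ne' (left.lap_pos (B.adjoint y)).ne',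
      Real.log_exp]
    simp only [logLap]
    ring

lemma LapFinite.exp_smul_of_eq {g : E d → ℝ} (hg : LapFinite g) {w : E d → E d → ℝ}
    {B : E d →L[ℝ] E d} {x : E d} (hw : ∀ y, w x y = logLap g (B x) + g y - ⟪B x, y⟫) :
    Measurable (w x) ∧ ∀ y, Real.exp (-w x y) • y
      = (lap g (B x))⁻¹ • Real.exp (-g y + ⟪B x, y⟫) • y := by
  have hm := hg.measurable
  constructor
  · rw [show w x = _ from funext hw]; fun_prop
  · intro y
    rw [smul_smul, ← hg.exp_logLap, ← Real.exp_neg, ← Real.exp_add, hw]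
    congr 2; ring

lemma LapFinite.integrable_gibbsKernel {g : E d → ℝ} (hg : LapFinite g) {w : E d → E d → ℝ}
    {B : E d →L[ℝ] E d} {x : E d} (hw : ∀ y, w x y = logLap g (B x) + g y - ⟪B x, y⟫) :
    Integrable (fun y => y) (gibbsKernel w x) := by
  obtain ⟨hm, he⟩ := hg.exp_smul_of_eq hw
  rw [integrable_gibbsKernel_iff hm]
  simp only [he]
  exact Integrable.smul (lap g (B x))⁻¹ (hg.integrable_smul (B x) (Φ := fun y => y) (by fun_prop)
    fun y => (Real.add_one_le_exp _).trans' (by linarith))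

lemma LapFinite.bary_eq_tiltedMean {g : E d → ℝ} (hg : LapFinite g) {w : E d → E d → ℝ}
    {B : E d →L[ℝ] E d} {x : E d} (hw : ∀ y, w x y = logLap g (B x) + g y - ⟪B x, y⟫) :
    bary w x = tiltedMean g (B x) := by
  obtain ⟨hm, he⟩ := hg.exp_smul_of_eq hw
  rw [bary, integral_gibbsKernel hm]
  simp only [he]
  rw [integral_smul, tiltedMean]

lemma linGaussPotential_eq (α : E d) (β : Mat d) {τ : Mat d} (hτ : τ.PosDef) :
    ∃ a b : E d → ℝ, Measurable a ∧ Measurable b ∧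
      ∀ x y, linGaussPotential α β τ x y = a x + b y - ⟪clm (τ⁻¹ * β) x, y⟫ := by
  have hdet : 0 < ((2 * Real.pi) • τ).det :=
    (hτ.smul (by positivity : (0 : ℝ) < 2 * Real.pi)).det_pos
  set c := (Real.sqrt ((2 * Real.pi) • τ).det)⁻¹
  have hc : c ≠ 0 := by positivity
  have hq : Measurable (quad τ⁻¹) := by
    have : quad τ⁻¹ = fun x : E d => ⟪clm τ⁻¹ x, x⟫ := funext (quad_eq_inner τ⁻¹)
    rw [this]; fun_prop
  refine ⟨fun x => 1 / 2 * quad τ⁻¹ (clm β x) + ⟪clm (τ⁻¹ * β) x, α⟫,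
    fun y => -Real.log c + 1 / 2 * quad τ⁻¹ (y - α), by fun_prop, by fun_prop, fun x y => ?_⟩
  have hz : WithLp.toLp 2 (β.mulVec x.ofLp) = clm β x := by
    ext i; simp [ofLp_clm]
  have hsym : ∀ z z' : E d, ⟪clm τ⁻¹ z, z'⟫ = ⟪clm τ⁻¹ z', z⟫ := fun z z' => by
    rw [← ContinuousLinearMap.adjoint_inner_right, adjoint_clm, posDef_transpose_eq hτ.inv,
      real_inner_comm]
  have e : linGaussPotential α β τ x y = -Real.log c + 1 / 2 * quad τ⁻¹ (y - (α + clm β x)) := by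
    rw [linGaussPotential, hz, gaussDensity, Real.log_mul hc (Real.exp_pos _).ne', Real.log_exp,
      quad]
    ring
  obtain ⟨z, rfl⟩ : ∃ z, y = z + α := ⟨y - α, by simp⟩
  rw [e, ← sub_sub]
  beta_reduce
  rw [add_sub_cancel_right]
  simp only [quad_eq_inner, map_sub, inner_sub_left, inner_sub_right, inner_add_right,
    clm_mul_apply, hsym z (clm β x)]
  ring

/-! ### Gradients of tilted means -/

lemma LapFinite.exists_hasFDerivAt_clm {f : E d → ℝ} (hf : LapFinite f) (θ : E d) :
    ∃ N : Mat d, N.IsSymm ∧ HasFDerivAt (tiltedMean f) (clm N) θ := by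
  obtain ⟨C, hC, hs⟩ := hf.exists_hasFDerivAt_tiltedMean θ
  set N : Mat d := (Matrix.toEuclideanCLM (n := Fin d) (𝕜 := ℝ)).symm C
  have hN : clm N = C := by simp [clm, N]
  refine ⟨N, ?_, by rwa [hN]⟩
  have h1 : clm N.transpose = clm N := by
    rw [← adjoint_clm, hN]
    refine ContinuousLinearMap.ext fun r => ext_inner_right ℝ fun s => ?_
    rw [ContinuousLinearMap.adjoint_inner_left, real_inner_comm, hs]
  exact (Matrix.toEuclideanCLM (n := Fin d) (𝕜 := ℝ)).injective h1

lemma gradMatrix_eq_transpose {h : E d → E d} {x : E d} {J : Mat d}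
    (hh : HasFDerivAt h (clm J) x) : gradMatrix h x = J.transpose := by
  ext i j
  simp [gradMatrix, hh.fderiv, ofLp_clm]

lemma gradMatrix_tiltedMean_comp_mul {f : E d → ℝ} {χ N : Mat d} {t : ℝ} {x : E d}
    (hN : N.IsSymm) (h : HasFDerivAt (tiltedMean f) (clm N) (clm (t⁻¹ • χ) x)) :
    gradMatrix (fun x => tiltedMean f (clm (t⁻¹ • χ) x)) x * χ
      = t⁻¹ • (χ.transpose * N * χ) := by
  have h1 : HasFDerivAt (fun x => tiltedMean f (clm (t⁻¹ • χ) x)) (clm (N * t⁻¹ • χ)) x := by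
    refine (h.comp x (clm (t⁻¹ • χ)).hasFDerivAt).congr_fderiv ?_
    ext1 s
    rw [clm_mul_apply]
    rfl
  rw [gradMatrix_eq_transpose h1, Matrix.transpose_mul, hN.eq, Matrix.transpose_smul,
    Matrix.smul_mul, Matrix.smul_mul]

lemma LapFinite.isSymm_gradMatrix {f : E d → ℝ} (hf : LapFinite f) (χ : Mat d) (t : ℝ) (x : E d) :
    (gradMatrix (fun x => tiltedMean f (clm (t⁻¹ • χ) x)) x * χ).IsSymm := by
  obtain ⟨N, hN, h⟩ := hf.exists_hasFDerivAt_clm (clm (t⁻¹ • χ) x)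
  rw [gradMatrix_tiltedMean_comp_mul hN h]
  refine Matrix.IsSymm.smul ?_ _
  rw [Matrix.IsSymm, Matrix.transpose_mul, Matrix.transpose_mul, hN.eq, Matrix.transpose_transpose,
    Matrix.mul_assoc]

lemma LapFinite.differentiableAt_tiltedMean_comp {f : E d → ℝ} (hf : LapFinite f)
    (B : E d →L[ℝ] E d) (x : E d) : DifferentiableAt ℝ (fun x => tiltedMean f (B x)) x := by
  obtain ⟨N, -, h⟩ := hf.exists_hasFDerivAt_clm (B x)
  exact (h.comp x B.hasFDerivAt).differentiableAt

lemma quad_gradMatrix_mul {f : E d → ℝ} {χ N : Mat d} {t : ℝ} (ht : 0 < t) {x : E d}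
    (hN : N.IsSymm) (h : HasFDerivAt (tiltedMean f) (clm N) (clm (t⁻¹ • χ) x)) (s : E d) :
    quad (gradMatrix (fun x => tiltedMean f (clm (t⁻¹ • χ) x)) x * χ) s
      = t * ⟪clm N (clm (t⁻¹ • χ) s), clm (t⁻¹ • χ) s⟫ := by
  rw [gradMatrix_tiltedMean_comp_mul hN h, quad_smul, quad_transpose_mul_mul, quad_eq_inner,
    clm_smul_apply, map_smul, inner_smul_left, inner_smul_right, RCLike.conj_to_real]
  field_simp

lemma LapFinite.quad_gradMatrix_le {f : E d → ℝ} (hf : LapFinite f) {χ : Mat d} {t : ℝ}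
    (ht : 0 < t) {x s : E d} {c : ℝ}
    (h : ∀ r : ℝ, secondDiff (logLap f) (clm (t⁻¹ • χ) x) (clm (t⁻¹ • χ) (r • s)) ≤
      r ^ 2 * (t⁻¹ * c)) :
    quad (gradMatrix (fun x => tiltedMean f (clm (t⁻¹ • χ) x)) x * χ) s ≤ c := by
  obtain ⟨N, hN, hd⟩ := hf.exists_hasFDerivAt_clm (clm (t⁻¹ • χ) x)
  have := hf.inner_le_of_secondDiff_le hd (fun r => by
    rw [← (clm (t⁻¹ • χ)).map_smul]; exact h r)
  rw [quad_gradMatrix_mul ht hN hd, ← le_div_iff₀' ht]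
  rwa [inv_mul_eq_div] at this

lemma LapFinite.le_quad_gradMatrix {f : E d → ℝ} (hf : LapFinite f) {χ : Mat d} {t : ℝ}
    (ht : 0 < t) {x s : E d} {c : ℝ}
    (h : ∀ r : ℝ, r ^ 2 * (t⁻¹ * c) ≤
      secondDiff (logLap f) (clm (t⁻¹ • χ) x) (clm (t⁻¹ • χ) (r • s))) :
    c ≤ quad (gradMatrix (fun x => tiltedMean f (clm (t⁻¹ • χ) x)) x * χ) s := by
  obtain ⟨N, hN, hd⟩ := hf.exists_hasFDerivAt_clm (clm (t⁻¹ • χ) x)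
  have := hf.le_inner_of_le_secondDiff hd (fun r => by
    rw [← (clm (t⁻¹ • χ)).map_smul]; exact h r)
  rw [quad_gradMatrix_mul ht hN hd, ← div_le_iff₀' ht]
  rwa [inv_mul_eq_div] at this

/-! ### Small-noise bounds -/

lemma coords_of_diagonalization {U V : E d → ℝ} {χ u v P : Mat d} {D : Fin d → ℝ} {t : ℝ}
    (ht : 0 < t) (hχ : IsUnit χ.det) (hP : IsUnit P.det) (hD : ∀ i, 0 < D i)
    (hw : (χ * u * χ.transpose)⁻¹ = P * Matrix.diagonal D * P.transpose)
    (hv : v⁻¹ = P⁻¹.transpose * Matrix.diagonal D * P⁻¹)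
    (hU : ∀ x s, secondDiff U x s ≤ quad u⁻¹ s) (hV : ∀ y s, quad v⁻¹ s ≤ secondDiff V y s) :
    Coords U V (clm (t⁻¹ • χ)) (clm (P.transpose * χ)) (clm P⁻¹) D t where
  t_pos := ht
  D_pos := hD
  surj := clm_surjective (by rw [Matrix.det_mul, Matrix.det_transpose]; exact hP.mul hχ)
  inner_eq x y := by
    have h1 : ∑ i, clm (P.transpose * χ) x i * clm P⁻¹ y i
        = ⟪clm (P.transpose * χ) x, clm P⁻¹ y⟫ := by
      rw [inner_eq_dotProduct]; rfl
    rw [h1, clm_mul_apply, ← adjoint_clm, ContinuousLinearMap.adjoint_inner_left,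
      ← clm_mul_apply, Matrix.mul_nonsing_inv _ hP, clm_smul_apply, inner_smul_left]
    simp [clm]
  left_le x s := by
    refine (hU x s).trans_eq ?_
    have hχ' : IsUnit χ.transpose.det := by rwa [Matrix.det_transpose]
    have h1 : u⁻¹ = (P.transpose * χ).transpose * Matrix.diagonal D * (P.transpose * χ) := by
      calc u⁻¹ = (χ.transpose * χ.transpose⁻¹) * u⁻¹ * (χ⁻¹ * χ) := by
            rw [Matrix.mul_nonsing_inv _ hχ', Matrix.nonsing_inv_mul _ hχ]; simp
        _ = χ.transpose * (χ * u * χ.transpose)⁻¹ * χ := by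
            simp only [Matrix.mul_inv_rev, Matrix.mul_assoc]
        _ = _ := by
            rw [hw, Matrix.transpose_mul, Matrix.transpose_transpose]
            simp only [Matrix.mul_assoc]
    rw [h1, quad_transpose_mul_mul, quad_diagonal]
  le_right y s := by
    refine le_trans (le_of_eq ?_) (hV y s)
    rw [hv, quad_transpose_mul_mul, quad_diagonal]

/-- The pair of bounds under an upper bound on the Hessian of `U` and a lower bound on that of `V`.
The upper bound holds for every `t`, the lower bound up to an error `O(t)`. -/
theorem asympUpper_and_asympLower {U V : E d → ℝ} (hU : ContDiff ℝ 2 U) (hV : ContDiff ℝ 2 V)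
    {χ u v : Mat d} (hχ : IsUnit χ.det) (hu : u.PosDef) (hv : v.PosDef)
    (hUu : ∀ x, LoewnerLE (hessMatrix U x) u⁻¹) (hVv : ∀ y, LoewnerLE v⁻¹ (hessMatrix V y))
    {f g : ℝ → E d → ℝ} (hfg : ∀ t > 0, LapSystem U V (clm (t⁻¹ • χ)) (f t) (g t))
    {K Kb : ℝ → E d → E d} (hK : ∀ t > 0, K t = fun x => tiltedMean (g t) (clm (t⁻¹ • χ) x))
    (hKb : ∀ t > 0, Kb t = fun y => tiltedMean (f t) (clm (t⁻¹ • χ.transpose) y)) (x : E d) :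
    AsympUpper (fun t => gradMatrix (K t) x * χ)
      (χ.transpose * geomMean (χ * u * χ.transpose)⁻¹ v * χ) ∧
    AsympLower (fun t => gradMatrix (Kb t) x * χ.transpose)
      (χ * geomMean (χ.transpose * v * χ)⁻¹ u * χ.transpose) := by
  have hw := (posDef_mul_mul_transpose hu ((Matrix.isUnit_iff_isUnit_det _).2 hχ)).inv
  obtain ⟨P, D, hP, hD, hG, hwP, hvP⟩ := exists_diagonalization_geomMean hw hv
  have hc : ∀ t > 0, Coords U V (clm (t⁻¹ • χ)) (clm (P.transpose * χ)) (clm P⁻¹) D t :=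
    fun t ht => coords_of_diagonalization ht hχ hP hD hwP hvP (secondDiff_le_quad hU hUu)
      (quad_le_secondDiff hV hVv)
  have hadj : ∀ t : ℝ, (clm (t⁻¹ • χ)).adjoint = clm (t⁻¹ • χ.transpose) := fun t => by
    rw [adjoint_clm, Matrix.transpose_smul]
  have hM1 : χ.transpose * geomMean (χ * u * χ.transpose)⁻¹ v * χ
      = (P.transpose * χ).transpose * (P.transpose * χ) := by
    rw [hG, Matrix.transpose_mul, Matrix.transpose_transpose]
    simp only [Matrix.mul_assoc]
  have hM2 : χ * geomMean (χ.transpose * v * χ)⁻¹ u * χ.transpose = P⁻¹.transpose * P⁻¹ := by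
    rw [mul_geomMean_mul_transpose hu hv hχ, hG, Matrix.mul_inv_rev, Matrix.transpose_nonsing_inv]
  rw [hM1, hM2]
  have symm : ∀ A : Mat d, (A.transpose * A).IsSymm := fun A => by
    rw [Matrix.IsSymm, Matrix.transpose_mul, Matrix.transpose_transpose]
  have sq_smul : ∀ (A : Mat d) (r : ℝ) (s : E d) (i : Fin d),
      clm A (r • s) i = r * clm A s i := fun A r s i => by simp
  refine ⟨asympUpper_of_quad_le (fun t ht => ?_) (symm _) fun t ht s => ?_,
    asympLower_of_le_quad (κ := ‖clm v⁻¹‖) (fun t ht => ?_) (symm _) fun t ht s => ?_⟩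
  · rw [hK t ht]; exact (hfg t ht).right.isSymm_gradMatrix χ t x
  · rw [hK t ht, quad_transpose_mul]
    refine (hfg t ht).right.quad_gradMatrix_le ht fun r => ?_
    refine ((hc t ht).secondDiff_logLap_right_le_sum (hfg t ht) x (r • s)).trans_eq ?_
    simp only [sq_smul, mul_pow, ← Finset.mul_sum]
    ring
  · rw [hKb t ht]; exact (hfg t ht).left.isSymm_gradMatrix χ.transpose t x
  · rw [hKb t ht, quad_transpose_mul]
    have h1 : ∑ i, clm P⁻¹ s i ^ 2 / (t * D i + 1) ≤ quad (gradMatrix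
        (fun y => tiltedMean (f t) (clm (t⁻¹ • χ.transpose) y)) x * χ.transpose) s := by
      refine (hfg t ht).left.le_quad_gradMatrix ht fun r => ?_
      rw [← hadj]
      refine le_trans (le_of_eq ?_)
        ((hc t ht).sum_le_secondDiff_logLap_left (hfg t ht) _ (r • s))
      simp only [sq_smul, mul_pow, mul_div_assoc, ← Finset.mul_sum]
      ring
    refine le_trans ?_ h1
    have h2 : ∑ i, D i * clm P⁻¹ s i ^ 2 ≤ ‖clm v⁻¹‖ * ‖s‖ ^ 2 := by
      rw [← quad_diagonal D, ← quad_transpose_mul_mul, ← hvP]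
      exact quad_le_norm _ _
    have h3 : ∑ i, clm P⁻¹ s i ^ 2 - t * ∑ i, D i * clm P⁻¹ s i ^ 2
        ≤ ∑ i, clm P⁻¹ s i ^ 2 / (t * D i + 1) := by
      rw [Finset.mul_sum, ← Finset.sum_sub_distrib]
      refine Finset.sum_le_sum fun i _ => ?_
      have hp : 0 < t * D i := mul_pos ht (hD i)
      rw [le_div_iff₀ (by linarith)]
      nlinarith [mul_nonneg (sq_nonneg (t * D i)) (sq_nonneg (clm P⁻¹ s i))]
    nlinarith [mul_le_mul_of_nonneg_left h2 (le_of_lt ht)]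

end EntropicMap

end

open EntropicMap in
theorem mainTheorem8 {d : ℕ} (U V : E d → ℝ)
    (hU : ContDiff ℝ 2 U) (hV : ContDiff ℝ 2 V)
    (hμ : MeasureTheory.IsProbabilityMeasure (gibbs U))
    (hη : MeasureTheory.IsProbabilityMeasure (gibbs V))
    (α : E d) (β τ₀ : Mat d) (hβ : IsUnit β.det) (hτ₀ : τ₀.PosDef)
    (W : ℝ → E d → E d → ℝ) (hW : ∀ t, W t = linGaussPotential α β (t • τ₀))
    (𝕌 𝕍 : ℝ → E d → ℝ)
    (hbridge : ∀ t : ℝ, 0 < t → IsBridgePotentials U V (W t) (𝕌 t) (𝕍 t))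
    (K : ℝ → E d → E d) (hK : ∀ t, K t = bary (fwdPotential U (W t) (𝕌 t) (𝕍 t)))
    (Kb : ℝ → E d → E d) (hKb : ∀ t, Kb t = bary (bwdPotential V (W t) (𝕌 t) (𝕍 t)))
    (χ₀ : Mat d) (hχ₀ : χ₀ = τ₀⁻¹ * β) :
    (∀ t : ℝ, 0 < t → ∀ x : E d,
      MeasureTheory.Integrable (fun y => y)
        (gibbsKernel (fwdPotential U (W t) (𝕌 t) (𝕍 t)) x) ∧
      MeasureTheory.Integrable (fun y => y)
        (gibbsKernel (bwdPotential V (W t) (𝕌 t) (𝕍 t)) x) ∧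
      DifferentiableAt ℝ (K t) x ∧ DifferentiableAt ℝ (Kb t) x ∧
      (gradMatrix (K t) x * χ₀).IsSymm ∧ (gradMatrix (Kb t) x * χ₀.transpose).IsSymm) ∧
    (∀ u_minus v_plus : Mat d, u_minus.PosDef → v_plus.PosDef →
      (∀ x, LoewnerLE (hessMatrix U x) u_minus⁻¹) →
      (∀ y, LoewnerLE v_plus⁻¹ (hessMatrix V y)) →
      ∀ x : E d,
        AsympUpper (fun t => gradMatrix (K t) x * χ₀)
          (χ₀.transpose * geomMean (χ₀ * u_minus * χ₀.transpose)⁻¹ v_plus * χ₀) ∧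
        AsympLower (fun t => gradMatrix (Kb t) x * χ₀.transpose)
          (χ₀ * geomMean (χ₀.transpose * v_plus * χ₀)⁻¹ u_minus * χ₀.transpose)) ∧
    (∀ u_plus v_minus : Mat d, u_plus.PosDef → v_minus.PosDef →
      (∀ x, LoewnerLE u_plus⁻¹ (hessMatrix U x)) →
      (∀ y, LoewnerLE (hessMatrix V y) v_minus⁻¹) →
      ∀ x : E d,
        AsympLower (fun t => gradMatrix (K t) x * χ₀)
          (χ₀.transpose * geomMean (χ₀ * u_plus * χ₀.transpose)⁻¹ v_minus * χ₀) ∧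
        AsympUpper (fun t => gradMatrix (Kb t) x * χ₀.transpose)
          (χ₀ * geomMean (χ₀.transpose * v_minus * χ₀)⁻¹ u_plus * χ₀.transpose)) := by
  have hχ : IsUnit χ₀.det := by
    rw [hχ₀, Matrix.det_mul]
    exact (isUnit_det_of_posDef hτ₀.inv).mul hβ
  have hχ' : IsUnit χ₀.transpose.det := by rwa [Matrix.det_transpose]
  have hadj : ∀ t : ℝ, (clm (t⁻¹ • χ₀)).adjoint = clm (t⁻¹ • χ₀.transpose) := fun t => by
    rw [adjoint_clm, Matrix.transpose_smul]
  have hex : ∀ t : ℝ, ∃ a b : E d → ℝ, 0 < t →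
      LapSystem U V (clm (t⁻¹ • χ₀)) (fun x => 𝕌 t x + a x) (fun y => 𝕍 t y + b y) ∧
      ∀ x y, W t x y = a x + b y - inner ℝ (clm (t⁻¹ • χ₀) x) y := by
    intro t
    -- The functions `a` and `b` matter for `t > 0` only.
    rcases le_or_gt t 0 with ht | ht
    · exact ⟨0, 0, fun h => absurd h ht.not_gt⟩
    obtain ⟨a, b, ha, hb, hab⟩ := linGaussPotential_eq α β (hτ₀.smul ht)
    have hinv : (t • τ₀)⁻¹ * β = t⁻¹ • χ₀ := by
      have : Invertible t := invertibleOfNonzero ht.ne'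
      rw [hχ₀, Matrix.inv_smul τ₀ t (isUnit_det_of_posDef hτ₀), Matrix.smul_mul, invOf_eq_inv]
    rw [hinv, ← hW] at hab
    have hs : ∀ A : Mat d, IsUnit A.det → IsUnit (t⁻¹ • A).det := fun A hA => by
      rw [Matrix.det_smul]
      exact ((inv_pos.2 ht).ne'.isUnit.pow _).mul hA
    refine ⟨a, b, fun _ => ⟨(hbridge t ht).1.lapSystem ha hb hab (clm_surjective (hs _ hχ)) ?_, hab⟩⟩
    rw [hadj]
    exact clm_surjective (hs _ hχ')
  choose a b hsys using hex
  have hfwd : ∀ t > 0, ∀ x y, fwdPotential U (W t) (𝕌 t) (𝕍 t) x y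
      = logLap (fun y => 𝕍 t y + b t y) (clm (t⁻¹ • χ₀) x) + (𝕍 t y + b t y)
        - inner ℝ (clm (t⁻¹ • χ₀) x) y := fun t ht x y => by
    have := (hsys t ht).1.left_eq x
    rw [fwdPotential, (hsys t ht).2]
    linarith
  have hbwd : ∀ t > 0, ∀ y x, bwdPotential V (W t) (𝕌 t) (𝕍 t) y x
      = logLap (fun x => 𝕌 t x + a t x) (clm (t⁻¹ • χ₀.transpose) y) + (𝕌 t x + a t x)
        - inner ℝ (clm (t⁻¹ • χ₀.transpose) y) x := fun t ht y x => by
    have := (hsys t ht).1.right_eq y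
    rw [← hadj, ContinuousLinearMap.adjoint_inner_left, real_inner_comm, bwdPotential,
      (hsys t ht).2]
    linarith
  have hK' : ∀ t > 0, K t
      = fun x => tiltedMean (fun y => 𝕍 t y + b t y) (clm (t⁻¹ • χ₀) x) := fun t ht => by
    rw [hK]
    exact funext fun x => (hsys t ht).1.right.bary_eq_tiltedMean (hfwd t ht x)
  have hKb' : ∀ t > 0, Kb t
      = fun y => tiltedMean (fun x => 𝕌 t x + a t x) (clm (t⁻¹ • χ₀.transpose) y) :=
    fun t ht => by
      rw [hKb]
      exact funext fun y => (hsys t ht).1.left.bary_eq_tiltedMean (hbwd t ht y)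
  refine ⟨fun t ht x => ⟨(hsys t ht).1.right.integrable_gibbsKernel (hfwd t ht x),
    (hsys t ht).1.left.integrable_gibbsKernel (hbwd t ht x), ?_, ?_, ?_, ?_⟩, ?_, ?_⟩
  · rw [hK' t ht]; exact (hsys t ht).1.right.differentiableAt_tiltedMean_comp _ x
  · rw [hKb' t ht]; exact (hsys t ht).1.left.differentiableAt_tiltedMean_comp _ x
  · rw [hK' t ht]; exact (hsys t ht).1.right.isSymm_gradMatrix χ₀ t x
  · rw [hKb' t ht]; exact (hsys t ht).1.left.isSymm_gradMatrix χ₀.transpose t x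
  · intro u v hu hv hUu hVv x
    exact asympUpper_and_asympLower hU hV hχ hu hv hUu hVv (fun t ht => (hsys t ht).1) hK' hKb' x
  · intro u v hu hv hUu hVv x
    have := asympUpper_and_asympLower hV hU (χ := χ₀.transpose) hχ' hv hu hVv hUu
      (fun t ht => hadj t ▸ (hsys t ht).1.swap) hKb' (Kb := K)
      (by simpa only [Matrix.transpose_transpose] using hK') x
    simp only [Matrix.transpose_transpose] at this
    exact this.symm
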